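/- Let $K$ be a field, $r\ge 0$, $\mathbb N=\{0,1,2,\dots\}$, and let $R=\bigoplus_{d\in\mathbb N^r}R_d$ be a commutative multigraded $K$-algebra of finite type, i.e. $R$ is finitely generated as a $K$-algebra and $R_0$ is a finite-dimensional $K$-vector space. Let $M=\bigoplus_{d\in\mathbb Z^r}M_d$ be a finitely generated multigraded $R$-module. For $t=(t_1,\dots,t_r)$ write $t^d=t_1^{d_1}\cdots t_r^{d_r}$. For a multigraded submodule $N\subseteq M$ let $H(N,t)=\sum_{d\in\mathbb Z^r}\dim_K(N_d)\,t^d$ be its Hilbert series. The universal denominator $\operatorname{udenom}(M,t)$ is the smallest polynomial $B(t)\in\mathbb Z[t_1,\dots,t_r]$ (with respect to divisibility) such that $B(0)=1$ and $B(t)H(N,t)$ is a Laurent polynomial for every multigraded submodule $N\subseteq M$. For $k\in\mathbb N$ let $\phi_k(t)\in\mathbb Z[t]$ be the polynomial in one variable with $\phi_k(0)=1$ that equals the $k$-th cyclotomic polynomial up to sign (and $\phi_0=1$). For $d=(d_1,\dots,d_r)\in\mathbb N^r$ put $\phi_d(t)=\phi_k(t^{d/k})$ with $k=\gcd(d_1,\dots,d_r)$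 if $d\neq 0$, and $\phi_0(t)=1$ for $d=0$. Say that $d$ divides $e$ in $\mathbb N^r$ if $e=kd$ for some $k\in\mathbb N$, and let $I^{[d]}\subseteq R$ be the ideal generated by all $R_e$ for which $d$ does not divide $e$. Let $m_d$ be the dimension of the support of $M/I^{[d]}M$ in $\operatorname{Spec}R$ (with $m_d=0$ for all $d$ if $M=0$). Then $\operatorname{udenom}(M,t)$ exists, each $m_d$ is finite, only finitely many $m_d$ are nonzero, and: (a) $\displaystyle \operatorname{udenom}(M,t)=\prod_{d\in\mathbb N^r}\phi_d(t)^{m_d}.$ (b) $\operatorname{udenom}(M,t)$ is the greatest common divisor in $\mathbb Z[t_1,\dots,t_r]$ of all products $(1-t^{d_1})(1-t^{d_2})\cdots(1-t^{d_s})$, $s\ge 0$, for which there exist homogeneous $f_1,\dots,f_s\in R$ of degrees $d_1,\dots,d_s\in\mathbb N^r$ respectively such that $M$ is a finitely generated $K[f_1,\dots,f_s]$-module. -/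

import Mathlib

namespace UnivDenom

noncomputable section

/-- The monomial `t^d = t₁^{d₁} ⋯ t_r^{d_r}`. -/
def tpow {r : ℕ} (d : Fin r → ℕ) : MvPolynomial (Fin r) ℤ :=
  ∏ i, MvPolynomial.X i ^ d i

/-- The polynomial `φ_k(t) ∈ ℤ[t]` with constant term `1` whose zeros are the primitive `k`-th roots
of unity: the cyclotomic polynomial, with its sign changed for `k = 1`. There are no primitive
`0`-th roots of unity, and `φ_0 = 1`. -/
def phi (k : ℕ) : Polynomial ℤ :=
  if k = 1 then 1 - Polynomial.X else Polynomial.cyclotomic k ℤ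

/-- `φ_d(t) = φ_k(t^{d/k})` for `d ∈ ℕ^r`, where `k = gcd(d₁, …, d_r)`. -/
def phiVec {r : ℕ} (d : Fin r → ℕ) : MvPolynomial (Fin r) ℤ :=
  Polynomial.aeval (tpow fun i => d i / Finset.univ.gcd d) (phi (Finset.univ.gcd d))

/-- Divisibility in `ℕ^r`: `d` divides `e` if `e = k d` for some `k ∈ ℕ`. -/
def VecDvd {r : ℕ} (d e : Fin r → ℕ) : Prop :=
  ∃ k : ℕ, e = k • d

/-- A formal Laurent series with integer coefficients, given by its coefficients. -/
abbrev FormalLaurent (r : ℕ) : Type :=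
  (Fin r → ℤ) → ℤ

/-- The product of a polynomial and a formal Laurent series:
the coefficient of `t^e` is `∑ₐ Bₐ H_{e-a}`. -/
def polyMul {r : ℕ} (B : MvPolynomial (Fin r) ℤ) (H : FormalLaurent r) : FormalLaurent r :=
  fun e => ∑ a ∈ B.support, B.coeff a * H (fun i => e i - (a i : ℤ))

/-- A formal Laurent series is a Laurent polynomial if only finitely many of its coefficients are
nonzero. -/
def IsLaurentPolynomial {r : ℕ} (H : FormalLaurent r) : Prop :=
  (Function.support H).Finite

section Module

variable {K R M : Type*} [Field K] [CommRing R] [Algebra K R] [AddCommGroup M] [Module K M]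
  [Module R M] [IsScalarTower K R M] {r : ℕ}

/-- The Hilbert series `∑_d dim_K(N ∩ M_d) t^d` of a graded submodule `N` of `M`. -/
def hilbertSeries (ℳ : (Fin r → ℤ) → Submodule K M) (N : Submodule R M) : FormalLaurent r :=
  fun d => (Module.finrank K ↥(N.restrictScalars K ⊓ ℳ d) : ℤ)

/-- `B(0) = 1`, and `B(t) H(N,t)` is a Laurent polynomial for every graded submodule `N` of `M`. -/
def IsCommonDenominator (R : Type*) [CommRing R] [Algebra K R] [Module R M] [IsScalarTower K R M]
    (ℳ : (Fin r → ℤ) → Submodule K M) [DirectSum.Decomposition ℳ]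
    (B : MvPolynomial (Fin r) ℤ) : Prop :=
  MvPolynomial.constantCoeff B = 1 ∧
    ∀ N : Submodule R M, N.IsHomogeneous ℳ →
      IsLaurentPolynomial (polyMul B (hilbertSeries ℳ N))

/-- `B` is a smallest (with respect to divisibility) polynomial with `B(0) = 1` such that
`B(t) H(N,t)` is a Laurent polynomial for every graded submodule `N` of `M`. -/
def IsUniversalDenominator (R : Type*) [CommRing R] [Algebra K R] [Module R M]
    [IsScalarTower K R M] (ℳ : (Fin r → ℤ) → Submodule K M) [DirectSum.Decomposition ℳ]
    (B : MvPolynomial (Fin r) ℤ) : Prop :=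
  IsCommonDenominator R ℳ B ∧ ∀ B', IsCommonDenominator R ℳ B' → B ∣ B'

open Classical in
/-- The universal denominator of the graded `R`-module `M` (`0` if there is none). -/
def udenom (R : Type*) [CommRing R] [Algebra K R] [Module R M] [IsScalarTower K R M]
    (ℳ : (Fin r → ℤ) → Submodule K M) [DirectSum.Decomposition ℳ] : MvPolynomial (Fin r) ℤ :=
  if h : ∃ B, IsUniversalDenominator R ℳ B then h.choose else 0

/-- The ideal `I^{[d]}` generated by all `R_e` such that `d` does not divide `e`. -/
def idealI (𝒜 : (Fin r → ℕ) → Submodule K R) (d : Fin r → ℕ) : Ideal R :=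
  Ideal.span {x | ∃ e, ¬ VecDvd d e ∧ x ∈ 𝒜 e}

/-- The dimension of the support of `M / I^{[d]} M`, in `{-∞, 0, 1, 2, …, ∞}`. -/
def suppDim (𝒜 : (Fin r → ℕ) → Submodule K R) (M : Type*) [AddCommGroup M] [Module R M]
    (d : Fin r → ℕ) : WithBot ℕ∞ :=
  Module.supportDim R (M ⧸ (idealI 𝒜 d • (⊤ : Submodule R M)))

/-- The exponent `m_d`: the dimension of the support of `M / I^{[d]} M` as a natural number,
where the dimension of the empty support is counted as `0`. -/
def mult (𝒜 : (Fin r → ℕ) → Submodule K R) (M : Type*) [AddCommGroup M] [Module R M]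
    (d : Fin r → ℕ) : ℕ :=
  ((suppDim 𝒜 M d).unbotD 0).toNat

/-- The set of all products `(1 - t^{d₁}) ⋯ (1 - t^{d_s})` such that `M` is a finitely generated
`K[f₁, …, f_s]`-module for some homogeneous `f₁, …, f_s ∈ R` of degrees `d₁, …, d_s`. -/
def parameterProducts (𝒜 : (Fin r → ℕ) → Submodule K R) (M : Type*) [AddCommGroup M]
    [Module R M] : Set (MvPolynomial (Fin r) ℤ) :=
  {p | ∃ (s : ℕ) (f : Fin s → R) (δ : Fin s → Fin r → ℕ),
    (∀ i, f i ∈ 𝒜 (δ i)) ∧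
    Module.Finite ↥(Algebra.adjoin K (Set.range f)) M ∧
    p = ∏ i, (1 - tpow (δ i))}

end Module

end

end UnivDenom

set_option linter.unusedSectionVars false

/-! Write `φ^n` for `∏ φ_d^{n_d}` (`phiProd`). The `φ_d` are pairwise relatively prime in `ℤ[t]`,
and `1 - t^d` is the product of the `φ_e` over the divisors `e` of `d`, each occurring once. Hence
products of factors `1 - t^d` with `d ≠ 0` are of the form `φ^n`, and `φ^(n ⊓ n')` is the gcd of
`φ^n` and `φ^n'`.

Upper bound. Fix `e ≠ 0`. Graded prime avoidance gives `m_e` elements with degrees in `ℕ e` which,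
together with homogeneous generators of `I^{[e]}` (degrees not divisible by `e`) and the annihilator
of `M`, generate an ideal with finite-dimensional quotient (`exists_system`). By graded Nakayama
(`finite_adjoin`), `M` is finite over the subalgebra they generate, so by Hilbert–Serre
(`isPoly_prod_mul_hilbertPowerSeries_sub`) the associated product clears denominators. It contains
`φ_e` at most `m_e` times. If two `φ^n` clear denominators, so does their gcd
(`IsPoly.of_isRelPrime`), and intersecting finitely many of these products yields a clearing `φ^n`
with `n ≤ m`.

Lower bound (`phiVec_pow_mult_dvd`). Some homogeneous generator `x` of `M` satisfies `dim R/(Ann x +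
I^{[e]}) ≥ m_e`. The module `Rx/I^{[e]}x` lives in degrees `deg x + ℕ e`, and the `m_e` parameters
are algebraically independent on it. Its Hilbert series therefore has a pole of order `m_e` at `t^e
= 1`, which forces `φ_e^{m_e}` to divide every common denominator.

Together these give (a). For (b), every parameter product clears denominators and so is a multiple
of `φ^m`. Conversely, a common divisor of all parameter products divides the gcd `φ^n` constructed
above, hence `φ^m`. -/

namespace UnivDenom

/-! ### Monomials in `ℤ[t]`. -/

section Monomials

open MvPolynomial

variable {r : ℕ}

theorem tpow_eq_monomial (d : Fin r → ℕ) :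
    tpow d = monomial (Finsupp.equivFunOnFinite.symm d) 1 := by
  rw [tpow, monomial_eq, Finsupp.prod_fintype]
  · simp
  · simp

theorem tpow_add (d e : Fin r → ℕ) : tpow (d + e) = tpow d * tpow e := by
  simp [tpow, pow_add, Finset.prod_mul_distrib]

theorem tpow_nsmul (k : ℕ) (d : Fin r → ℕ) : tpow (k • d) = tpow d ^ k := by
  simp [tpow, ← Finset.prod_pow, ← pow_mul, mul_comm]

theorem tpow_injective : Function.Injective (tpow (r := r)) := by
  intro d e h
  rw [tpow_eq_monomial, tpow_eq_monomial] at h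
  exact Finsupp.equivFunOnFinite.symm.injective (monomial_left_injective one_ne_zero h)

theorem constantCoeff_tpow {d : Fin r → ℕ} (hd : d ≠ 0) : constantCoeff (tpow d) = 0 := by
  obtain ⟨i, hi⟩ := Function.ne_iff.mp hd
  rw [tpow, map_prod]
  exact Finset.prod_eq_zero (Finset.mem_univ i) (by simpa using hi)

theorem degreeOf_tpow (d : Fin r → ℕ) (i : Fin r) : degreeOf i (tpow d) = d i := by
  rw [tpow_eq_monomial, degreeOf_monomial_eq _ _ one_ne_zero]
  rfl

theorem one_sub_tpow_ne_zero {d : Fin r → ℕ} (hd : d ≠ 0) : (1 - tpow d) ≠ 0 := by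
  intro h
  have := congrArg constantCoeff h
  simp [constantCoeff_tpow hd] at this

theorem constantCoeff_aeval_tpow {d : Fin r → ℕ} (hd : d ≠ 0) (p : Polynomial ℤ) :
    constantCoeff (Polynomial.aeval (tpow d) p) = p.coeff 0 := by
  induction p using Polynomial.induction_on' with
  | add p q hp hq => simp [hp, hq]
  | monomial n a => 
    rcases Nat.eq_zero_or_pos n with rfl | hn
    · simp
    · simp [Polynomial.aeval_monomial, constantCoeff_tpow hd, hn.ne', Polynomial.coeff_monomial]

end Monomials

/-! ### Relative primality in `ℤ[t]` by elimination of variables. -/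

section RelPrime

open MvPolynomial

variable {r : ℕ}

theorem isUnit_of_dvd_of_degreeOf {p c : MvPolynomial (Fin r) ℤ} (hp : IsUnit (constantCoeff p))
    (hc : c ∣ p) (h : ∀ i, degreeOf i c = 0) : IsUnit c := by
  rw [isUnit_iff_totalDegree_of_isReduced]
  refine ⟨isUnit_of_dvd_unit (map_dvd constantCoeff hc) hp, ?_⟩
  refine Nat.le_zero.mp ((totalDegree_le_degrees_card c).trans ?_)
  have : c.degrees = 0 := Multiset.eq_zero_of_forall_notMem fun i hi =>
    Multiset.count_ne_zero.mpr hi (by simpa [degreeOf] using h i)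
  simp [this]

theorem degreeOf_eq_zero_of_dvd {i : Fin r} {c q : MvPolynomial (Fin r) ℤ} (hq : q ≠ 0)
    (h : c ∣ q) (hi : degreeOf i q = 0) : degreeOf i c = 0 := by
  obtain ⟨b, rfl⟩ := h
  rw [degreeOf_mul_eq (left_ne_zero_of_mul hq) (right_ne_zero_of_mul hq)] at hi
  omega

/-- A divisor of a nonzero polynomial free of `X i` is itself free of `X i`. A common divisor is
thus a constant, and it divides `p(0) = 1`. This replaces a Bézout identity, which need not exist in
several variables. -/
theorem isRelPrime_of_elimination {p q : MvPolynomial (Fin r) ℤ} (hp : constantCoeff p = 1)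
    (h : ∀ i, ∃ g, g ≠ 0 ∧ degreeOf i g = 0 ∧ ∀ c, c ∣ p → c ∣ q → c ∣ g) : IsRelPrime p q := by
  intro c hcp hcq
  refine isUnit_of_dvd_of_degreeOf (by simp [hp]) hcp fun i => ?_
  obtain ⟨g, hg, hgi, hc⟩ := h i
  exact degreeOf_eq_zero_of_dvd hg (hc c hcp hcq) hgi

theorem isRelPrime_of_combination {p q a b : MvPolynomial (Fin r) ℤ} {n : ℤ}
    (hp : constantCoeff p = 1) (hn : n ≠ 0) (h : a * p + b * q = C n) : IsRelPrime p q :=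
  isRelPrime_of_elimination hp fun i => ⟨C n, by simpa using hn, degreeOf_C n i, fun c hcp hcq =>
    h ▸ dvd_add (hcp.mul_left a) (hcq.mul_left b)⟩

theorem isRelPrime_tpow {p : MvPolynomial (Fin r) ℤ} (hp : constantCoeff p = 1) (d : Fin r → ℕ) :
    IsRelPrime p (tpow d) := by
  refine IsRelPrime.prod_right fun i _ => ?_
  refine IsRelPrime.pow_right ?_
  refine ((X_prime (R := ℤ) (i := i)).irreducible.isRelPrime_iff_not_dvd.mpr ?_).symm
  rintro ⟨g, rfl⟩
  simp at hp

theorem one_sub_tpow_dvd (k : ℕ) (d : Fin r → ℕ) : 1 - tpow d ∣ 1 - tpow (k • d) := by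
  rw [tpow_nsmul]
  simpa using sub_dvd_pow_sub_pow 1 (tpow d) k

theorem degreeOf_one_sub_tpow {d : Fin r → ℕ} {i : Fin r} (hi : d i = 0) :
    degreeOf i (1 - tpow d) = 0 := by
  have := degreeOf_sub_le i 1 (tpow d)
  rw [degreeOf_tpow, hi, degreeOf_one] at this
  simpa using this

/-- The vectors lie on different rays. The powers `t^{e_i d}` and `t^{d_i e}` have the same exponent
at `X i`; they differ because the rays do, and both are `1` modulo a common divisor. Cancelling
their common power of `X i` leaves a nonzero difference without `X i`. -/
theorem isRelPrime_one_sub_tpow {d e : Fin r → ℕ} (hd : d ≠ 0) (he : e ≠ 0)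
    (h : ∀ a b : ℕ, a ≠ 0 → b ≠ 0 → a • d ≠ b • e) : IsRelPrime (1 - tpow d) (1 - tpow e) := by
  have hd1 : constantCoeff (1 - tpow d) = 1 := by simp [constantCoeff_tpow hd]
  refine isRelPrime_of_elimination hd1 fun i => ?_
  by_cases hdi : d i = 0
  · exact ⟨_, one_sub_tpow_ne_zero hd, degreeOf_one_sub_tpow hdi, fun _ h _ => h⟩
  by_cases hei : e i = 0
  · exact ⟨_, one_sub_tpow_ne_zero he, degreeOf_one_sub_tpow hei, fun _ _ h => h⟩
  set u : Fin r → ℕ := Function.update (e i • d) i 0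
  set v : Fin r → ℕ := Function.update (d i • e) i 0
  set w : Fin r → ℕ := Pi.single i (e i * d i)
  have hu : e i • d = w + u := by
    ext j; by_cases hj : j = i
    · subst hj; simp [u, w]
    · simp [u, w, hj]
  have hv : d i • e = w + v := by
    ext j; by_cases hj : j = i
    · subst hj; simp [v, w, mul_comm]
    · simp [v, w, hj]
  refine ⟨tpow u - tpow v, fun huv => h (e i) (d i) hei hdi ?_, ?_, fun c hcd hce => ?_⟩
  · rw [hu, hv, tpow_injective (sub_eq_zero.mp huv)]
  · have := degreeOf_sub_le i (tpow u) (tpow v)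
    rw [degreeOf_tpow, degreeOf_tpow] at this
    simpa [u, v] using this
  · have hc1 : IsRelPrime c (tpow w) := (isRelPrime_tpow hd1 w).of_dvd_left hcd
    refine hc1.dvd_of_dvd_mul_left ?_
    have := dvd_sub (hce.trans (one_sub_tpow_dvd (d i) e)) (hcd.trans (one_sub_tpow_dvd (e i) d))
    rw [hu, hv, tpow_add, tpow_add] at this
    convert this using 1
    ring

end RelPrime

/-! ### The polynomials `φ_k` and `φ_d`. -/

section Phi

open MvPolynomial

variable {r : ℕ}

theorem phi_zero : phi 0 = 1 := by simp [phi]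

theorem phi_coeff_zero (k : ℕ) : (phi k).coeff 0 = 1 := by
  unfold phi
  split_ifs with h
  · simp
  · rcases Nat.lt_or_ge 1 k with hk | hk
    · exact Polynomial.cyclotomic_coeff_zero ℤ hk
    · obtain rfl : k = 0 := by omega
      simp

theorem phi_associated (k : ℕ) : Associated (phi k) (Polynomial.cyclotomic k ℤ) := by
  unfold phi
  split_ifs with h
  · subst h
    rw [Polynomial.cyclotomic_one, ← neg_sub]
    exact (Associated.refl _).neg_left
  · rfl

theorem prod_phi {n : ℕ} (hn : 0 < n) : ∏ k ∈ n.divisors, phi k = 1 - Polynomial.X ^ n := by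
  have h1 : 1 ∈ n.divisors := by simpa using hn.ne'
  have h := Polynomial.prod_cyclotomic_eq_X_pow_sub_one hn ℤ
  rw [← Finset.mul_prod_erase _ _ h1] at h ⊢
  rw [Finset.prod_congr rfl (g := fun k => Polynomial.cyclotomic k ℤ)
    (fun k hk => by simp [phi, Finset.ne_of_mem_erase hk])]
  -- The sign of `φ_1` is what turns `X^n - 1` into `1 - X^n`.
  rw [← neg_sub, ← h]
  simp [phi]
  ring

/-- Clearing the denominators of a Bézout identity over `ℚ` leaves a nonzero integer on the right;
`isRelPrime_of_combination` needs no more than that. -/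
theorem exists_combination_of_isCoprime_map {p q : Polynomial ℤ}
    (h : IsCoprime (p.map (Int.castRingHom ℚ)) (q.map (Int.castRingHom ℚ))) :
    ∃ (a b : Polynomial ℤ) (n : ℤ), n ≠ 0 ∧ a * p + b * q = Polynomial.C n := by
  obtain ⟨a, b, hab⟩ := h
  obtain ⟨m, hm0, hm⟩ := IsLocalization.integerNormalization_spec (nonZeroDivisors ℤ) a
  obtain ⟨n, hn0, hn⟩ := IsLocalization.integerNormalization_spec (nonZeroDivisors ℤ) b
  refine ⟨Polynomial.C n * IsLocalization.integerNormalization (nonZeroDivisors ℤ) a,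
    Polynomial.C m * IsLocalization.integerNormalization (nonZeroDivisors ℤ) b, m * n,
    mul_ne_zero (nonZeroDivisors.ne_zero hm0) (nonZeroDivisors.ne_zero hn0), ?_⟩
  apply Polynomial.map_injective (Int.castRingHom ℚ) Int.cast_injective
  have e : algebraMap ℤ ℚ = Int.castRingHom ℚ := rfl
  rw [e] at hm hn
  simp only [Polynomial.map_add, Polynomial.map_mul, Polynomial.map_C, hm, hn]
  simp only [zsmul_eq_mul, map_mul, map_intCast, eq_intCast]
  linear_combination (m : Polynomial ℚ) * (n : Polynomial ℚ) * hab

theorem exists_combination_phi {k l : ℕ} (h : k ≠ l) :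
    ∃ (a b : Polynomial ℤ) (n : ℤ), n ≠ 0 ∧ a * phi k + b * phi l = Polynomial.C n := by
  apply exists_combination_of_isCoprime_map
  have hk := (phi_associated k).map (Polynomial.mapRingHom (Int.castRingHom ℚ))
  have hl := (phi_associated l).map (Polynomial.mapRingHom (Int.castRingHom ℚ))
  simp only [Polynomial.coe_mapRingHom, Polynomial.map_cyclotomic] at hk hl
  exact ((Polynomial.cyclotomic.isCoprime_rat h).of_isCoprime_of_dvd_left
    hk.dvd).of_isCoprime_of_dvd_right hl.dvd

theorem gcd_nsmul (k : ℕ) (u : Fin r → ℕ) : Finset.univ.gcd (k • u) = k * Finset.univ.gcd u := by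
  exact (Finset.gcd_mul_left (s := Finset.univ) (f := u) (a := k)).trans (by rw [normalize_eq])

theorem gcd_ne_zero {d : Fin r → ℕ} (hd : d ≠ 0) : Finset.univ.gcd d ≠ 0 := by
  rw [Ne, Finset.gcd_eq_zero_iff]
  exact fun h => hd (funext fun i => h i (Finset.mem_univ i))

/-- The primitive vector `d / gcd(d)`. -/
def primitivePart (d : Fin r → ℕ) : Fin r → ℕ := fun i => d i / Finset.univ.gcd d

theorem nsmul_primitivePart (d : Fin r → ℕ) : Finset.univ.gcd d • primitivePart d = d := by
  ext i
  simpa [primitivePart] using Nat.mul_div_cancel' (Finset.gcd_dvd (f := d) (Finset.mem_univ i))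

theorem gcd_primitivePart {d : Fin r → ℕ} (hd : d ≠ 0) : Finset.univ.gcd (primitivePart d) = 1 := by
  obtain ⟨i, hi⟩ := Function.ne_iff.mp hd
  exact Finset.gcd_div_eq_one (Finset.mem_univ i) hi

theorem primitivePart_nsmul {u : Fin r → ℕ} (hu : Finset.univ.gcd u = 1) {k : ℕ} (hk : k ≠ 0) :
    primitivePart (k • u) = u := by
  ext i
  rw [primitivePart, gcd_nsmul, hu, mul_one]
  exact Nat.mul_div_cancel_left _ (Nat.pos_of_ne_zero hk)

theorem ne_zero_of_gcd {u : Fin r → ℕ} (hu : Finset.univ.gcd u = 1) : u ≠ 0 := by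
  rintro rfl
  exact zero_ne_one ((Finset.gcd_eq_zero_iff.mpr fun _ _ => rfl).symm.trans hu)

theorem primitivePart_ne_zero {d : Fin r → ℕ} (hd : d ≠ 0) : primitivePart d ≠ 0 :=
  ne_zero_of_gcd (gcd_primitivePart hd)

theorem phiVec_eq (d : Fin r → ℕ) :
    phiVec d = Polynomial.aeval (tpow (primitivePart d)) (phi (Finset.univ.gcd d)) := rfl

theorem phiVec_zero : phiVec (0 : Fin r → ℕ) = 1 := by
  have : Finset.univ.gcd (0 : Fin r → ℕ) = 0 := Finset.gcd_eq_zero_iff.mpr fun _ _ => rfl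
  rw [phiVec_eq, this, phi_zero, map_one]

theorem phiVec_nsmul {u : Fin r → ℕ} (hu : Finset.univ.gcd u = 1) {k : ℕ} (hk : k ≠ 0) :
    phiVec (k • u) = Polynomial.aeval (tpow u) (phi k) := by
  rw [phiVec_eq, primitivePart_nsmul hu hk, gcd_nsmul, hu, mul_one]

theorem constantCoeff_phiVec (d : Fin r → ℕ) : constantCoeff (phiVec d) = 1 := by
  by_cases hd : d = 0
  · rw [hd, phiVec_zero, map_one]
  · rw [phiVec_eq, constantCoeff_aeval_tpow (primitivePart_ne_zero hd), phi_coeff_zero]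

theorem prod_phiVec {d : Fin r → ℕ} (hd : d ≠ 0) :
    ∏ k ∈ (Finset.univ.gcd d).divisors, phiVec (k • primitivePart d) = 1 - tpow d := by
  rw [Finset.prod_congr rfl fun k hk =>
    phiVec_nsmul (gcd_primitivePart hd) (Nat.pos_of_mem_divisors hk).ne', ← map_prod,
    prod_phi (Nat.pos_of_ne_zero (gcd_ne_zero hd))]
  rw [map_sub, map_one, map_pow, Polynomial.aeval_X, ← tpow_nsmul, nsmul_primitivePart]

theorem phiVec_dvd_one_sub_tpow {d : Fin r → ℕ} (hd : d ≠ 0) : phiVec d ∣ 1 - tpow d := by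
  rw [← prod_phiVec hd]
  have := Finset.dvd_prod_of_mem (fun k => phiVec (k • primitivePart d))
    (Nat.mem_divisors_self _ (gcd_ne_zero hd))
  rwa [nsmul_primitivePart] at this

/-- On a common ray, substitute `t^u` into an integral combination of two distinct `φ_k`; on
different rays, pass to the multiples `1 - t^d` and `1 - t^e`. -/
theorem isRelPrime_phiVec {d e : Fin r → ℕ} (h : d ≠ e) : IsRelPrime (phiVec d) (phiVec e) := by
  by_cases hd : d = 0
  · rw [hd, phiVec_zero]; exact isRelPrime_one_left
  by_cases he : e = 0
  · rw [he, phiVec_zero]; exact isRelPrime_one_right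
  by_cases huv : primitivePart d = primitivePart e
  · have hg : Finset.univ.gcd d ≠ Finset.univ.gcd e := fun hg => h <| by
      rw [← nsmul_primitivePart d, ← nsmul_primitivePart e, huv, hg]
    obtain ⟨a, b, n, hn, hab⟩ := exists_combination_phi hg
    refine isRelPrime_of_combination (constantCoeff_phiVec d) hn
      (a := Polynomial.aeval (tpow (primitivePart d)) a)
      (b := Polynomial.aeval (tpow (primitivePart d)) b) ?_
    rw [phiVec_eq, phiVec_eq, ← huv, ← map_mul, ← map_mul, ← map_add, hab]
    simp
  · refine IsRelPrime.of_dvd_left (IsRelPrime.of_dvd_right (isRelPrime_one_sub_tpow hd he ?_)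
      (phiVec_dvd_one_sub_tpow he)) (phiVec_dvd_one_sub_tpow hd)
    intro a b ha hb hab
    apply huv
    rw [← nsmul_primitivePart d, ← nsmul_primitivePart e, smul_smul, smul_smul] at hab
    rw [← primitivePart_nsmul (gcd_primitivePart hd) (mul_ne_zero ha (gcd_ne_zero hd)), hab,
      primitivePart_nsmul (gcd_primitivePart he) (mul_ne_zero hb (gcd_ne_zero he))]

end Phi

/-! ### Products of the `φ_d` and their gcds. -/

section PhiProd

open MvPolynomial

variable {r : ℕ}

/-- The product `∏_d φ_d(t)^{n_d}`. -/
noncomputable def phiProd (n : (Fin r → ℕ) →₀ ℕ) : MvPolynomial (Fin r) ℤ := n.prod fun d m => phiVec d ^ m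

theorem phiProd_add (n n' : (Fin r → ℕ) →₀ ℕ) : phiProd (n + n') = phiProd n * phiProd n' :=
  Finsupp.prod_add_index' (fun _ => pow_zero _) fun _ _ _ => pow_add _ _ _

theorem phiProd_zero : phiProd (0 : (Fin r → ℕ) →₀ ℕ) = 1 := Finsupp.prod_zero_index

theorem phiProd_sum {ι : Type*} (s : Finset ι) (n : ι → (Fin r → ℕ) →₀ ℕ) :
    phiProd (∑ i ∈ s, n i) = ∏ i ∈ s, phiProd (n i) := by
  classical
  induction s using Finset.induction_on with
  | empty => simp [phiProd_zero]
  | insert i s hi ih => rw [Finset.sum_insert hi, Finset.prod_insert hi, phiProd_add, ih]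

theorem phiProd_single (d : Fin r → ℕ) : phiProd (Finsupp.single d 1) = phiVec d := by
  simp [phiProd]

theorem constantCoeff_phiProd (n : (Fin r → ℕ) →₀ ℕ) : constantCoeff (phiProd n) = 1 := by
  simp [phiProd, Finsupp.prod, map_prod, constantCoeff_phiVec]

theorem phiProd_ne_zero (n : (Fin r → ℕ) →₀ ℕ) : phiProd n ≠ 0 := by
  intro h
  have := constantCoeff_phiProd n
  simp [h] at this

theorem phiProd_dvd_phiProd {n n' : (Fin r → ℕ) →₀ ℕ} (h : n ≤ n') : phiProd n ∣ phiProd n' := by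
  rw [← add_tsub_cancel_of_le h, phiProd_add]
  exact dvd_mul_right _ _

theorem isRelPrime_phiProd {n n' : (Fin r → ℕ) →₀ ℕ} (h : ∀ d, n d = 0 ∨ n' d = 0) :
    IsRelPrime (phiProd n) (phiProd n') := by
  refine IsRelPrime.prod_left fun d hd => IsRelPrime.prod_right fun e he =>
    IsRelPrime.pow (isRelPrime_phiVec ?_)
  rintro rfl
  rw [Finsupp.mem_support_iff] at hd he
  exact (h d).elim hd he

theorem exists_isRelPrime_phiProd (n n' : (Fin r → ℕ) →₀ ℕ) :
    ∃ a b, a ≠ 0 ∧ IsRelPrime a b ∧ phiProd n = phiProd (n ⊓ n') * a ∧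
      phiProd n' = phiProd (n ⊓ n') * b := by
  refine ⟨phiProd (n - n ⊓ n'), phiProd (n' - n ⊓ n'), phiProd_ne_zero _,
    isRelPrime_phiProd fun d => ?_, ?_, ?_⟩
  · simp only [Finsupp.coe_tsub, Pi.sub_apply, Finsupp.inf_apply]
    rcases le_total (n d) (n' d) with h | h
    · left; simp [h]
    · right; simp [h]
  · rw [← phiProd_add, add_tsub_cancel_of_le inf_le_left]
  · rw [← phiProd_add, add_tsub_cancel_of_le inf_le_right]

theorem dvd_phiProd_inf {c : MvPolynomial (Fin r) ℤ} {n n' : (Fin r → ℕ) →₀ ℕ}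
    (h : c ∣ phiProd n) (h' : c ∣ phiProd n') : c ∣ phiProd (n ⊓ n') := by
  obtain ⟨a, b, -, hab, hn, hn'⟩ := exists_isRelPrime_phiProd n n'
  rw [hn] at h
  rw [hn'] at h'
  -- Split `c = x y` with `x` dividing the gcd and `y` dividing `a`. As `y` is prime to `b`, it must
  -- divide the remaining factor `g` of the gcd.
  obtain ⟨x, y, hx, hy, rfl⟩ := exists_dvd_and_dvd_of_dvd_mul h
  have hx0 : x ≠ 0 := fun h0 => phiProd_ne_zero (n ⊓ n') (zero_dvd_iff.mp (h0 ▸ hx))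
  obtain ⟨g, hg⟩ := hx
  rw [hg] at h' ⊢
  rw [mul_assoc] at h'
  have hyb : y ∣ g * b := (mul_dvd_mul_iff_left hx0).mp h'
  exact mul_dvd_mul_left x ((hab.of_dvd_left hy).dvd_of_dvd_mul_right hyb)

/-- The indicator function of the divisors of `d`. -/
noncomputable def divisorIndicator (d : Fin r → ℕ) : (Fin r → ℕ) →₀ ℕ :=
  ∑ k ∈ (Finset.univ.gcd d).divisors, Finsupp.single (k • primitivePart d) 1

theorem phiProd_divisorIndicator {d : Fin r → ℕ} (hd : d ≠ 0) :
    phiProd (divisorIndicator d) = 1 - tpow d := by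
  simp only [divisorIndicator, phiProd_sum, phiProd_single, prod_phiVec hd]

theorem divisorIndicator_le_one {d : Fin r → ℕ} (hd : d ≠ 0) (e : Fin r → ℕ) :
    divisorIndicator d e ≤ 1 := by
  classical
  simp only [divisorIndicator, Finsupp.coe_finsetSum, Finset.sum_apply, Finsupp.single_apply]
  rw [Finset.sum_boole, Nat.cast_id, Finset.card_le_one]
  intro k hk l hl
  have h := (Finset.mem_filter.mp hk).2.trans (Finset.mem_filter.mp hl).2.symm
  obtain ⟨i, hi⟩ := Function.ne_iff.mp (primitivePart_ne_zero hd)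
  exact Nat.eq_of_mul_eq_mul_right (Nat.pos_of_ne_zero hi) (congrFun h i)

theorem divisorIndicator_eq_zero {d e : Fin r → ℕ} (h : ¬ VecDvd e d) :
    divisorIndicator d e = 0 := by
  classical
  simp only [divisorIndicator, Finsupp.coe_finsetSum, Finset.sum_apply, Finsupp.single_apply]
  refine Finset.sum_eq_zero fun k hk => if_neg ?_
  rintro rfl
  refine h ⟨Finset.univ.gcd d / k, ?_⟩
  rw [smul_smul, Nat.div_mul_cancel (Nat.dvd_of_mem_divisors hk), nsmul_primitivePart]

theorem finite_setOf_vecDvd {d : Fin r → ℕ} (hd : d ≠ 0) : {e | VecDvd e d}.Finite := by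
  refine (Set.finite_Iic d).subset ?_
  rintro e ⟨k, rfl⟩
  have hk : 0 < k := Nat.pos_of_ne_zero fun h => hd (by simp [h])
  exact fun i => Nat.le_mul_of_pos_left _ hk

end PhiProd

/-! ### Laurent series bounded below as shifted power series. -/

section Series

variable {r : ℕ}

/-- A power series is polynomial if it has only finitely many nonzero coefficients. -/
def IsPoly (F : MvPowerSeries (Fin r) ℤ) : Prop :=
  ∃ p : MvPolynomial (Fin r) ℤ, (p : MvPowerSeries (Fin r) ℤ) = F

theorem isPoly_coe (p : MvPolynomial (Fin r) ℤ) : IsPoly (p : MvPowerSeries (Fin r) ℤ) := ⟨p, rfl⟩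

theorem IsPoly.mul {F G : MvPowerSeries (Fin r) ℤ} (hF : IsPoly F) (hG : IsPoly G) :
    IsPoly (F * G) := by
  obtain ⟨p, rfl⟩ := hF
  obtain ⟨q, rfl⟩ := hG
  exact ⟨p * q, MvPolynomial.coe_mul p q⟩

theorem IsPoly.sub {F G : MvPowerSeries (Fin r) ℤ} (hF : IsPoly F) (hG : IsPoly G) :
    IsPoly (F - G) := by
  obtain ⟨p, rfl⟩ := hF
  obtain ⟨q, rfl⟩ := hG
  refine ⟨p - q, ?_⟩
  simpa using map_sub (MvPolynomial.coeToMvPowerSeries.ringHom (R := ℤ) (σ := Fin r)) p q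

theorem isPoly_of_finite {F : MvPowerSeries (Fin r) ℤ}
    (h : {a | MvPowerSeries.coeff a F ≠ 0}.Finite) : IsPoly F := by
  classical
  refine ⟨∑ a ∈ h.toFinset, MvPolynomial.monomial a (MvPowerSeries.coeff a F), ?_⟩
  ext b
  rw [MvPolynomial.coeff_coe, MvPolynomial.coeff_sum]
  simp only [MvPolynomial.coeff_monomial, Finset.sum_ite_eq', Set.Finite.mem_toFinset,
    Set.mem_ofPred_eq]
  split_ifs with hb
  · rfl
  · exact (not_not.mp hb).symm

theorem IsPoly.finite {F : MvPowerSeries (Fin r) ℤ} (h : IsPoly F) :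
    {a | MvPowerSeries.coeff a F ≠ 0}.Finite := by
  obtain ⟨p, rfl⟩ := h
  refine p.support.finite_toSet.subset fun a ha => ?_
  simpa using ha

/-- If `g a F` and `g b F` are polynomials with `a` and `b` relatively prime, then so is `g F`. -/
theorem IsPoly.of_isRelPrime {F : MvPowerSeries (Fin r) ℤ} {g a b : MvPolynomial (Fin r) ℤ}
    (ha0 : a ≠ 0) (hab : IsRelPrime a b) (ha : IsPoly (((g * a : MvPolynomial (Fin r) ℤ) : MvPowerSeries (Fin r) ℤ) * F))
    (hb : IsPoly (((g * b : MvPolynomial (Fin r) ℤ) : MvPowerSeries (Fin r) ℤ) * F)) :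
    IsPoly ((g : MvPowerSeries (Fin r) ℤ) * F) := by
  obtain ⟨p, hp⟩ := ha
  obtain ⟨q, hq⟩ := hb
  rw [MvPolynomial.coe_mul] at hp hq
  have h : b * p = a * q := by
    rw [← MvPolynomial.coe_inj, MvPolynomial.coe_mul, MvPolynomial.coe_mul, hp, hq]
    ring
  -- From `b p = a q`, relative primality gives `a ∣ p`; the quotient is `g F`.
  obtain ⟨s, rfl⟩ : a ∣ p := hab.dvd_of_dvd_mul_left ⟨q, h⟩
  refine ⟨s, ?_⟩
  have ha' : (a : MvPowerSeries (Fin r) ℤ) ≠ 0 := by simpa using ha0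
  apply mul_left_cancel₀ ha'
  rw [← MvPolynomial.coe_mul, hp]
  ring

/-- The power series obtained from a formal Laurent series by dividing by `t^c`. -/
def shiftSeries (c : Fin r → ℤ) (H : FormalLaurent r) : MvPowerSeries (Fin r) ℤ :=
  fun a => H (fun i => (a i : ℤ) + c i)

theorem coeff_shiftSeries (c : Fin r → ℤ) (H : FormalLaurent r) (a : Fin r →₀ ℕ) :
    MvPowerSeries.coeff a (shiftSeries c H) = H (fun i => (a i : ℤ) + c i) := rfl

theorem polyMul_eq_sum {B : MvPolynomial (Fin r) ℤ} {s : Finset (Fin r →₀ ℕ)} (hs : B.support ⊆ s)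
    (H : FormalLaurent r) (e : Fin r → ℤ) :
    polyMul B H e = ∑ a ∈ s, B.coeff a * H (fun i => e i - (a i : ℤ)) :=
  Finset.sum_subset hs fun a _ ha => by simp [MvPolynomial.notMem_support_iff.mp ha]

theorem polyMul_add (B B' : MvPolynomial (Fin r) ℤ) (H : FormalLaurent r) :
    polyMul (B + B') H = polyMul B H + polyMul B' H := by
  classical
  ext e
  rw [Pi.add_apply, polyMul_eq_sum MvPolynomial.support_add, polyMul_eq_sum (B := B)
    Finset.subset_union_left, polyMul_eq_sum (B := B') Finset.subset_union_right,
    ← Finset.sum_add_distrib]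
  simp [add_mul]

theorem polyMul_monomial (b : Fin r →₀ ℕ) (m : ℤ) (H : FormalLaurent r) (e : Fin r → ℤ) :
    polyMul (MvPolynomial.monomial b m) H e = m * H (fun i => e i - (b i : ℤ)) := by
  classical
  rw [polyMul_eq_sum MvPolynomial.support_monomial_subset]
  simp

/-- The bound on the support is essential: coefficients not above `c` are forgotten by the shift but
could reappear after multiplication by `B`. -/
theorem shiftSeries_polyMul {c : Fin r → ℤ} {H : FormalLaurent r} (hH : ∀ e, H e ≠ 0 → c ≤ e)
    (B : MvPolynomial (Fin r) ℤ) :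
    shiftSeries c (polyMul B H) = (B : MvPowerSeries (Fin r) ℤ) * shiftSeries c H := by
  induction B using MvPolynomial.induction_on' with
  | monomial b m =>
    classical
    ext a
    rw [coeff_shiftSeries, polyMul_monomial, MvPolynomial.coe_monomial,
      MvPowerSeries.coeff_monomial_mul]
    split_ifs with h
    · rw [coeff_shiftSeries]
      congr 2
      ext i
      have : b i ≤ a i := h i
      simp only [Finsupp.coe_tsub, Pi.sub_apply]
      push_cast [this]
      ring
    · by_contra h0
      refine h fun i => ?_
      have := hH _ (right_ne_zero_of_mul h0) i
      simp only at this
      omega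
  | add B B' hB hB' =>
    rw [polyMul_add, MvPolynomial.coe_add, add_mul, ← hB, ← hB']
    rfl

theorem le_of_polyMul_ne_zero {c : Fin r → ℤ} {H : FormalLaurent r} (hH : ∀ e, H e ≠ 0 → c ≤ e)
    (B : MvPolynomial (Fin r) ℤ) (e : Fin r → ℤ) (he : polyMul B H e ≠ 0) : c ≤ e := by
  obtain ⟨a, -, ha⟩ := Finset.exists_ne_zero_of_sum_ne_zero he
  intro i
  have : c i ≤ e i - (a i : ℤ) := hH _ (right_ne_zero_of_mul ha) i
  show c i ≤ e i
  omega

theorem isLaurentPolynomial_iff {c : Fin r → ℤ} {H : FormalLaurent r}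
    (hH : ∀ e, H e ≠ 0 → c ≤ e) : IsLaurentPolynomial H ↔ IsPoly (shiftSeries c H) := by
  constructor
  · intro h
    refine isPoly_of_finite (h.preimage (f := fun (a : Fin r →₀ ℕ) i => (a i : ℤ) + c i) ?_)
    intro a _ b _ hab
    ext i
    simpa using congrFun hab i
  · intro h
    refine (h.finite.image (fun (a : Fin r →₀ ℕ) i => (a i : ℤ) + c i)).subset fun e he => ?_
    have hc : ∀ i, (((e i - c i).toNat : ℕ) : ℤ) + c i = e i := fun i => by
      have : c i ≤ e i := hH e he i
      omega
    refine ⟨Finsupp.equivFunOnFinite.symm fun i => (e i - c i).toNat, ?_, ?_⟩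
    · rw [Set.mem_ofPred_eq, coeff_shiftSeries]
      exact fun h0 => he ((congrArg H (funext hc)).symm.trans h0)
    · exact funext hc

theorem isLaurentPolynomial_polyMul_iff {c : Fin r → ℤ} {H : FormalLaurent r}
    (hH : ∀ e, H e ≠ 0 → c ≤ e) (B : MvPolynomial (Fin r) ℤ) :
    IsLaurentPolynomial (polyMul B H) ↔ IsPoly ((B : MvPowerSeries (Fin r) ℤ) * shiftSeries c H) := by
  rw [isLaurentPolynomial_iff (le_of_polyMul_ne_zero hH B), shiftSeries_polyMul hH]

end Series

/-! ### Homogeneous components and graded submodules. -/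

section Graded

variable {K R M : Type*} [Field K] [CommRing R] [Algebra K R] [AddCommGroup M] [Module K M]
  [Module R M] [IsScalarTower K R M] {r : ℕ}

/-- The projection of a graded module onto its component of degree `d`. -/
noncomputable def proj (ℳ : (Fin r → ℤ) → Submodule K M) [DirectSum.Decomposition ℳ] (d : Fin r → ℤ) : M →ₗ[K] M :=
  (ℳ d).subtype ∘ₗ DirectSum.component K _ _ d ∘ₗ (DirectSum.decomposeLinearEquiv ℳ).toLinearMap

variable (𝒜 : (Fin r → ℕ) → Submodule K R) [GradedAlgebra 𝒜]
  (ℳ : (Fin r → ℤ) → Submodule K M) [DirectSum.Decomposition ℳ]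

theorem proj_apply (d : Fin r → ℤ) (x : M) : proj ℳ d x = (DirectSum.decompose ℳ x d : M) := rfl

theorem proj_mem (d : Fin r → ℤ) (x : M) : proj ℳ d x ∈ ℳ d := (DirectSum.decompose ℳ x d).2

theorem proj_of_mem {d : Fin r → ℤ} {x : M} (hx : x ∈ ℳ d) : proj ℳ d x = x :=
  DirectSum.decompose_of_mem_same ℳ hx

theorem proj_of_mem_of_ne {d e : Fin r → ℤ} {x : M} (hx : x ∈ ℳ d) (h : d ≠ e) : proj ℳ e x = 0 :=
  DirectSum.decompose_of_mem_ne ℳ hx h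

theorem finite_setOf_proj_ne_zero (x : M) : {d | proj ℳ d x ≠ 0}.Finite := by
  classical
  refine (DFinsupp.support (DirectSum.decompose ℳ x)).finite_toSet.subset fun d hd => ?_
  rw [Finset.mem_coe, DFinsupp.mem_support_toFun]
  exact fun h => hd (by rw [proj_apply, h]; rfl)

theorem sum_proj (x : M) : ∑ d ∈ (finite_setOf_proj_ne_zero ℳ x).toFinset, proj ℳ d x = x := by
  classical
  conv_rhs => rw [← DirectSum.sum_support_decompose ℳ x]
  symm
  refine Finset.sum_subset_zero_on_sdiff (fun d hd => ?_) (fun d hd => ?_) fun d _ => rfl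
  · rw [Set.Finite.mem_toFinset]
    rw [DFinsupp.mem_support_toFun] at hd
    exact fun h => hd (Subtype.ext h)
  · have := (Finset.mem_sdiff.mp hd).2
    rw [DFinsupp.mem_support_toFun, not_not] at this
    rw [proj_apply, this]; rfl

variable {𝒜 ℳ}

/-- Multiplication by an element of degree `e` maps `ℳ d` to `ℳ (e + d)`. -/
def GradedAction (𝒜 : (Fin r → ℕ) → Submodule K R) (ℳ : (Fin r → ℤ) → Submodule K M) : Prop :=
  ∀ (e : Fin r → ℕ) (d : Fin r → ℤ), ∀ a ∈ 𝒜 e, ∀ x ∈ ℳ d, a • x ∈ ℳ (fun i => (e i : ℤ) + d i)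

theorem proj_smul (hsmul : GradedAction 𝒜 ℳ) {δ : Fin r → ℕ} {a : R} (ha : a ∈ 𝒜 δ) (e : Fin r → ℤ) (x : M) :
    proj ℳ e (a • x) = a • proj ℳ (fun i => e i - δ i) x := by
  induction x using DirectSum.Decomposition.inductionOn ℳ with
  | zero => simp
  | @homogeneous d x =>
    have hx := hsmul δ d a ha x x.2
    by_cases h : (fun i => (δ i : ℤ) + d i) = e
    · subst h
      rw [proj_of_mem ℳ hx]
      have : (fun i => (δ i : ℤ) + d i - δ i) = d := by ext i; ring
      rw [this, proj_of_mem ℳ x.2]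
    · rw [proj_of_mem_of_ne ℳ hx h, proj_of_mem_of_ne ℳ x.2, smul_zero]
      rintro rfl
      exact h (by ext i; ring)
  | add x y hx hy => rw [smul_add, map_add, hx, hy, map_add, smul_add]

theorem proj_smul_mem (hsmul : GradedAction 𝒜 ℳ) {N : Submodule R M} {x : M} (hx : ∀ d, proj ℳ d x ∈ N) (a : R)
    (e : Fin r → ℤ) : proj ℳ e (a • x) ∈ N := by
  induction a using DirectSum.Decomposition.inductionOn 𝒜 with
  | zero => simp
  | @homogeneous δ a => rw [proj_smul hsmul a.2]; exact N.smul_mem _ (hx _)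
  | add a b ha hb => rw [add_smul, map_add]; exact N.add_mem ha hb

theorem isHomogeneous_span (hsmul : GradedAction 𝒜 ℳ) {S : Set M} (hS : ∀ x ∈ S, ∃ d, x ∈ ℳ d) :
    (Submodule.span R S).IsHomogeneous ℳ := by
  intro e x hx
  rw [← proj_apply]
  induction hx using Submodule.span_induction generalizing e with
  | mem x hx =>
    obtain ⟨d, hd⟩ := hS x hx
    by_cases h : d = e
    · subst h
      rw [proj_of_mem ℳ hd]
      exact Submodule.subset_span hx
    · rw [proj_of_mem_of_ne ℳ hd h]
      exact zero_mem _
  | zero => simp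
  | add x y _ _ hx hy => rw [map_add]; exact add_mem (hx e) (hy e)
  | smul a x _ hx => exact proj_smul_mem hsmul hx a e

theorem isHomogeneous_sup {N N' : Submodule R M} (hN : N.IsHomogeneous ℳ)
    (hN' : N'.IsHomogeneous ℳ) : (N ⊔ N').IsHomogeneous ℳ := by
  intro e x hx
  obtain ⟨y, hy, z, hz, rfl⟩ := Submodule.mem_sup.mp hx
  rw [← proj_apply, map_add]
  exact Submodule.add_mem_sup (hN e hy) (hN' e hz)

theorem isHomogeneous_map_smul (hsmul : GradedAction 𝒜 ℳ) {N : Submodule R M} (hN : N.IsHomogeneous ℳ) {δ : Fin r → ℕ} {f : R}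
    (hf : f ∈ 𝒜 δ) : (N.map (f • LinearMap.id)).IsHomogeneous ℳ := by
  rintro e _ ⟨x, hx, rfl⟩
  rw [← proj_apply]
  exact ⟨_, hN (fun i => e i - δ i) hx, (proj_smul hsmul hf e x).symm⟩

theorem isHomogeneous_inf_comap_smul (hsmul : GradedAction 𝒜 ℳ) {N N' : Submodule R M} (hN : N.IsHomogeneous ℳ)
    (hN' : N'.IsHomogeneous ℳ) {δ : Fin r → ℕ} {f : R} (hf : f ∈ 𝒜 δ) :
    (N ⊓ N'.comap (f • LinearMap.id)).IsHomogeneous ℳ := by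
  rintro e x ⟨hx, hx'⟩
  refine ⟨hN e hx, ?_⟩
  have := hN' (fun i => e i + δ i) hx'
  rw [← proj_apply, LinearMap.smul_apply, LinearMap.id_apply, proj_smul hsmul hf] at this
  simp only [add_sub_cancel_right] at this
  exact this

variable (R ℳ) in
theorem exists_homogeneous_generators [Module.Finite R M] :
    ∃ T : Finset M, (∀ x ∈ T, ∃ d, x ∈ ℳ d) ∧ Submodule.span R (T : Set M) = ⊤ := by
  classical
  obtain ⟨S, hS⟩ := Module.Finite.fg_top (R := R) (M := M)
  refine ⟨S.biUnion fun x => (finite_setOf_proj_ne_zero ℳ x).toFinset.image fun d => proj ℳ d x,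
    fun x hx => ?_, ?_⟩
  · simp only [Finset.mem_biUnion, Finset.mem_image] at hx
    obtain ⟨y, -, d, -, rfl⟩ := hx
    exact ⟨d, proj_mem ℳ d y⟩
  · rw [← top_le_iff, ← hS, Submodule.span_le]
    intro x hx
    rw [← sum_proj ℳ x]
    refine Submodule.sum_mem _ fun d hd => Submodule.subset_span ?_
    simp only [Finset.coe_biUnion, Set.mem_iUnion, Finset.coe_image]
    exact ⟨x, hx, d, hd, rfl⟩

/-- Degrees in `R` are nonnegative, so a lower bound for the degrees of finitely many homogeneous
generators bounds all degrees of `M`. -/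
theorem exists_lower_bound (hsmul : GradedAction 𝒜 ℳ) [Module.Finite R M] :
    ∃ c : Fin r → ℤ, ∀ d, ∀ x ∈ ℳ d, x ≠ 0 → c ≤ d := by
  classical
  obtain ⟨T, hT, hspan⟩ := exists_homogeneous_generators R ℳ
  choose! deg hdeg using hT
  obtain ⟨c, hc⟩ : ∃ c : Fin r → ℤ, ∀ x ∈ T, c ≤ deg x := by
    obtain ⟨c, hc⟩ := (T.image deg).bddBelow
    exact ⟨c, fun x hx => hc (by simpa using ⟨x, hx, rfl⟩)⟩
  refine ⟨c, ?_⟩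
  have key : ∀ x : M, ∀ d, proj ℳ d x ≠ 0 → c ≤ d := by
    intro x
    have hx : x ∈ Submodule.span R (T : Set M) := hspan ▸ trivial
    induction hx using Submodule.span_induction with
    | mem x hx =>
      intro d hd
      have : deg x = d := by
        by_contra h
        exact hd (proj_of_mem_of_ne ℳ (hdeg x hx) h)
      exact this ▸ hc x hx
    | zero => simp
    | add x y _ _ hx hy =>
      intro d hd
      by_cases h : proj ℳ d x = 0
      · exact hy d fun h' => hd (by rw [map_add, h, h', add_zero])
      · exact hx d h
    | smul a x _ hx =>
      induction a using DirectSum.Decomposition.inductionOn 𝒜 with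
      | zero => simp
      | @homogeneous δ a =>
        intro d hd
        rw [proj_smul hsmul a.2] at hd
        have := hx _ (right_ne_zero_of_smul hd)
        intro i
        have : c i ≤ d i - δ i := this i
        show c i ≤ d i
        omega
      | add a b ha hb =>
        intro d hd
        rw [add_smul, map_add] at hd
        by_cases h : proj ℳ d (a • x) = 0
        · exact hb d fun h' => hd (by rw [h, h', add_zero])
        · exact ha d h
  intro d x hx hx0
  exact key x d (by rwa [proj_of_mem ℳ hx])

end Graded

/-- Induction on the total degree: subtracting a nonzero `δ` lowers it, and `c ≤ d` fails once it
drops below that of `c`. -/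
theorem degree_induction {r : ℕ} {P : (Fin r → ℤ) → Prop} (c : Fin r → ℤ) (h0 : ∀ d, ¬ c ≤ d → P d)
    (step : ∀ d, (∀ δ : Fin r → ℕ, δ ≠ 0 → P (fun i => d i - δ i)) → P d) (d : Fin r → ℤ) : P d := by
  suffices h : ∀ (n : ℕ) (d : Fin r → ℤ), ∑ i, d i < ∑ i, c i + n → P d from
    h (∑ i, d i - ∑ i, c i + 1).toNat d (by have := Int.self_le_toNat (∑ i, d i - ∑ i, c i + 1); linarith)
  intro n
  induction n with
  | zero =>
    intro d hd
    refine h0 d fun hcd => ?_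
    have := Finset.sum_le_sum fun i (_ : i ∈ Finset.univ) => hcd i
    simp at hd
    linarith
  | succ n ih =>
    intro d hd
    refine step d fun δ hδ => ih _ ?_
    have : 0 < ∑ i, (δ i : ℤ) := by
      obtain ⟨i, hi⟩ := Function.ne_iff.mp hδ
      refine Finset.sum_pos' (fun _ _ => by positivity) ⟨i, Finset.mem_univ i, ?_⟩
      exact_mod_cast Nat.pos_of_ne_zero hi
    rw [Finset.sum_sub_distrib]
    push_cast at hd
    linarith

/-! ### Finiteness by graded Nakayama. -/

section Nakayama

variable {K R M : Type*} [Field K] [CommRing R] [Algebra K R] [AddCommGroup M] [Module K M]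
  [Module R M] [IsScalarTower K R M] {r : ℕ}
  {𝒜 : (Fin r → ℕ) → Submodule K R} [GradedAlgebra 𝒜]
  {ℳ : (Fin r → ℤ) → Submodule K M} [DirectSum.Decomposition ℳ] {ι : Type*} [Fintype ι]

/-- Modulo the annihilator, every scalar is a combination of finitely many lifts plus an element of
the ideal generated by the `h i`. Applying this to module generators gives `T`. -/
theorem exists_finset_span_sup {h : ι → R} [Module.Finite R M]
    [Module.Finite K (R ⧸ (Module.annihilator R M ⊔ Ideal.span (Set.range h)))] :
    ∃ T : Finset M, ∀ x : M, ∃ w ∈ Submodule.span K (T : Set M), ∃ z : ι → M,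
      x = w + ∑ i, h i • z i := by
  classical
  set B := Module.annihilator R M ⊔ Ideal.span (Set.range h) with hB
  obtain ⟨S, hS⟩ := Module.Finite.fg_top (R := R) (M := M)
  obtain ⟨Q, hQ⟩ := Module.Finite.fg_top (R := K) (M := R ⧸ B)
  choose lift hlift using Ideal.Quotient.mk_surjective (I := B)
  have hR : ∀ a : R, ∃ b ∈ Submodule.span K (Q.image lift : Set R), ∃ ρ : ι → R,
      a - (b + ∑ i, h i * ρ i) ∈ Module.annihilator R M := by
    intro a
    have ha : Ideal.Quotient.mk B a ∈ Submodule.span K (Q : Set (R ⧸ B)) := hQ ▸ trivial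
    have hQ' : (Q : Set (R ⧸ B)) = (Ideal.Quotient.mkₐ K B).toLinearMap '' (Q.image lift : Set R) := by
      rw [Finset.coe_image, Set.image_image]
      simp [hlift]
    rw [hQ', ← Submodule.map_span] at ha
    obtain ⟨b, hb, hab⟩ := ha
    have : a - b ∈ B := by
      rw [← Ideal.Quotient.eq]
      exact hab.symm
    obtain ⟨α, hα, β, hβ, hαβ⟩ := Submodule.mem_sup.mp this
    obtain ⟨ρ, hρ⟩ := (Submodule.mem_span_range_iff_exists_fun R).mp hβ
    refine ⟨b, hb, ρ, ?_⟩
    convert hα using 1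
    have : ∑ i, h i * ρ i = β := by rw [← hρ]; simp [mul_comm]
    rw [this]
    linear_combination -hαβ
  refine ⟨(Q.image lift ×ˢ S).image fun p => p.1 • p.2, fun x => ?_⟩
  -- Quantifying over the multiples of `x` lets the span induction pass through scalar
  -- multiplication.
  suffices key : ∀ a : R, ∃ w ∈ Submodule.span K
      (((Q.image lift ×ˢ S).image fun p => p.1 • p.2 : Finset M) : Set M), ∃ z : ι → M,
      a • x = w + ∑ i, h i • z i by simpa using key 1
  have hx : x ∈ Submodule.span R (S : Set M) := hS ▸ trivial
  induction hx using Submodule.span_induction with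
  | mem x hx =>
    intro a
    obtain ⟨b, hb, ρ, hρ⟩ := hR a
    refine ⟨b • x, ?_, fun i => ρ i • x, ?_⟩
    · have : b • x = ((LinearMap.toSpanSingleton R M x).restrictScalars K) b := rfl
      rw [this]
      refine Submodule.span_mono ?_ (Submodule.apply_mem_span_image_of_mem_span _ hb)
      rintro _ ⟨q, hq, rfl⟩
      exact Finset.mem_coe.mpr (Finset.mem_image.mpr ⟨(q, x), Finset.mem_product.mpr ⟨hq, hx⟩, rfl⟩)
    · have := Module.mem_annihilator.mp hρ x
      rw [sub_smul, add_smul, Finset.sum_smul, sub_eq_zero] at this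
      simpa only [mul_smul] using this
  | zero => exact fun a => ⟨0, zero_mem _, 0, by simp⟩
  | add x y _ _ hx hy =>
    intro a
    obtain ⟨w, hw, z, hz⟩ := hx a
    obtain ⟨w', hw', z', hz'⟩ := hy a
    refine ⟨w + w', add_mem hw hw', z + z', ?_⟩
    simp only [Pi.add_apply, smul_add, Finset.sum_add_distrib, hz, hz']
    abel
  | smul b x _ hx => exact fun a => by simpa only [smul_smul] using hx (a * b)

/-- A finite-dimensional complement to `∑ hᵢ M` can be chosen to be graded. -/
theorem exists_finset_homogeneous (hsmul : GradedAction 𝒜 ℳ) {h : ι → R} {δ : ι → Fin r → ℕ}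
    (hh : ∀ i, h i ∈ 𝒜 (δ i)) [Module.Finite R M]
    [Module.Finite K (R ⧸ (Module.annihilator R M ⊔ Ideal.span (Set.range h)))] :
    ∃ T : Finset M, ∀ d, ∀ x ∈ ℳ d, ∃ w ∈ Submodule.span K (T : Set M), ∃ z : ι → M,
      (∀ i, z i ∈ ℳ (fun j => d j - δ i j)) ∧ x = w + ∑ i, h i • z i := by
  classical
  obtain ⟨T, hT⟩ := exists_finset_span_sup (K := K) (M := M) (h := h)
  refine ⟨T.biUnion fun x => (finite_setOf_proj_ne_zero ℳ x).toFinset.image fun d => proj ℳ d x,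
    fun d x hx => ?_⟩
  obtain ⟨w, hw, z, hxw⟩ := hT x
  refine ⟨proj ℳ d w, ?_, fun i => proj ℳ (fun j => d j - δ i j) (z i), fun i => proj_mem ℳ _ _, ?_⟩
  · refine (Submodule.span_le.mpr ?_) (Submodule.apply_mem_span_image_of_mem_span (proj ℳ d) hw)
    rintro _ ⟨y, hy, rfl⟩
    by_cases h0 : proj ℳ d y = 0
    · rw [h0]; exact zero_mem _
    · refine Submodule.subset_span (Finset.mem_coe.mpr (Finset.mem_biUnion.mpr ⟨y, hy, ?_⟩))
      exact Finset.mem_image.mpr ⟨d, by simpa using h0, rfl⟩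
  · conv_lhs => rw [← proj_of_mem ℳ hx, hxw]
    rw [map_add, map_sum]
    simp only [proj_smul hsmul (hh _)]

/-- The homogeneous components of `M` are finite-dimensional. -/
theorem finite_component (hsmul : GradedAction 𝒜 ℳ) {h : ι → R} {δ : ι → Fin r → ℕ}
    (hh : ∀ i, h i ∈ 𝒜 (δ i)) (hδ : ∀ i, δ i ≠ 0) [Module.Finite R M]
    [Module.Finite K (R ⧸ (Module.annihilator R M ⊔ Ideal.span (Set.range h)))] (d : Fin r → ℤ) :
    FiniteDimensional K (ℳ d) := by
  obtain ⟨T, hT⟩ := exists_finset_homogeneous hsmul hh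
  obtain ⟨c, hc⟩ := exists_lower_bound hsmul
  induction d using degree_induction c with
  | h0 d hd =>
    have : ℳ d = ⊥ := (Submodule.eq_bot_iff _).mpr fun x hx => by_contra fun h0 => hd (hc d x hx h0)
    rw [this]
    infer_instance
  | step d ih =>
    have hfin : ∀ i, FiniteDimensional K (ℳ fun j => d j - δ i j) := fun i => ih (δ i) (hδ i)
    have hle : ℳ d ≤ Submodule.span K (T : Set M) ⊔
        ⨆ i, (ℳ fun j => d j - δ i j).map ((h i • LinearMap.id : M →ₗ[R] M).restrictScalars K) := by
      intro x hx
      obtain ⟨w, hw, z, hz, rfl⟩ := hT d x hx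
      refine Submodule.add_mem_sup hw (Submodule.sum_mem _ fun i _ => ?_)
      exact Submodule.mem_iSup_of_mem i ⟨z i, hz i, rfl⟩
    exact Submodule.finiteDimensional_of_le hle

/-- The graded Nakayama lemma. -/
theorem finite_adjoin (hsmul : GradedAction 𝒜 ℳ) {h : ι → R} {δ : ι → Fin r → ℕ}
    (hh : ∀ i, h i ∈ 𝒜 (δ i)) (hδ : ∀ i, δ i ≠ 0) [Module.Finite R M]
    [Module.Finite K (R ⧸ (Module.annihilator R M ⊔ Ideal.span (Set.range h)))] :
    Module.Finite (Algebra.adjoin K (Set.range h)) M := by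
  obtain ⟨T, hT⟩ := exists_finset_homogeneous hsmul hh
  obtain ⟨c, hc⟩ := exists_lower_bound hsmul
  refine ⟨⟨T, ?_⟩⟩
  -- Since `δ i ≠ 0`, the coefficients `z i` have lower degree and are covered by the induction.
  have key : ∀ d, ∀ x ∈ ℳ d, x ∈ Submodule.span (Algebra.adjoin K (Set.range h)) (T : Set M) := by
    intro d
    induction d using degree_induction c with
    | h0 d hd =>
      intro x hx
      have : x = 0 := by_contra fun h0 => hd (hc d x hx h0)
      rw [this]
      exact zero_mem _
    | step d ih =>
      intro x hx
      obtain ⟨w, hw, z, hz, rfl⟩ := hT d x hx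
      refine add_mem (Submodule.span_subset_span K _ _ hw) (Submodule.sum_mem _ fun i _ => ?_)
      exact Submodule.smul_mem _ (⟨h i, Algebra.subset_adjoin ⟨i, rfl⟩⟩ : Algebra.adjoin K (Set.range h))
        (ih (δ i) (hδ i) _ (hz i))
  refine top_le_iff.mp fun x _ => ?_
  rw [← sum_proj ℳ x]
  exact Submodule.sum_mem _ fun d _ => key d _ (proj_mem ℳ d x)

end Nakayama

/-! ### Hilbert series of subquotients and the Hilbert–Serre theorem. -/

section HilbertSerre

variable {K R M : Type*} [Field K] [CommRing R] [Algebra K R] [AddCommGroup M] [Module K M]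
  [Module R M] [IsScalarTower K R M] {r : ℕ}
  {𝒜 : (Fin r → ℕ) → Submodule K R} [GradedAlgebra 𝒜]
  {ℳ : (Fin r → ℤ) → Submodule K M} [DirectSum.Decomposition ℳ]

theorem finrank_map_add_finrank_inf_ker {V W : Type*} [AddCommGroup V] [Module K V]
    [AddCommGroup W] [Module K W] (g : V →ₗ[K] W) (U : Submodule K V) [FiniteDimensional K U] :
    Module.finrank K (U.map g) + Module.finrank K ↥(LinearMap.ker g ⊓ U) = Module.finrank K U := by
  have h := LinearMap.finrank_range_add_finrank_ker (g.domRestrict U)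
  rw [LinearMap.range_domRestrict] at h
  rw [← h, LinearMap.ker_domRestrict]
  congr 1
  rw [LinearEquiv.finrank_eq (Submodule.equivSubtypeMap U ((LinearMap.ker g).comap U.subtype)),
    Submodule.map_comap_subtype, inf_comm]

/-- For `N' ≤ N`, the dimension of `(N/N')_d` is the difference of the Hilbert functions. -/
theorem hilbertSeries_eq_add [∀ d, FiniteDimensional K (ℳ d)] {N N' : Submodule R M} (h : N' ≤ N)
    (d : Fin r → ℤ) : hilbertSeries ℳ N d = hilbertSeries ℳ N' d +
      Module.finrank K ((N.restrictScalars K ⊓ ℳ d).map (N'.mkQ.restrictScalars K)) := by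
  have : FiniteDimensional K ↥(N.restrictScalars K ⊓ ℳ d) :=
    Submodule.finiteDimensional_of_le inf_le_right
  have key := finrank_map_add_finrank_inf_ker (N'.mkQ.restrictScalars K)
    (N.restrictScalars K ⊓ ℳ d)
  have hker : LinearMap.ker (N'.mkQ.restrictScalars K) = N'.restrictScalars K := by
    ext x; simp
  rw [hker, ← inf_assoc, inf_eq_left.mpr (show N'.restrictScalars K ≤ N.restrictScalars K from h)]
    at key
  rw [hilbertSeries, hilbertSeries, ← key]
  push_cast
  ring

theorem le_of_hilbertSeries_ne_zero {c : Fin r → ℤ} (hc : ∀ d, ∀ x ∈ ℳ d, x ≠ 0 → c ≤ d)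
    (N : Submodule R M) (d : Fin r → ℤ) (hd : hilbertSeries ℳ N d ≠ 0) : c ≤ d := by
  by_contra h
  apply hd
  have : N.restrictScalars K ⊓ ℳ d = ⊥ :=
    (Submodule.eq_bot_iff _).mpr fun x hx => by_contra fun h0 => h (hc d x hx.2 h0)
  rw [hilbertSeries, this, finrank_bot]
  rfl

/-- Rank–nullity for multiplication by `f` from `N` in degree `e - δ` to `M/N'` in degree `e`: the
kernel comes from `N ⊓ (N' : f)`, the image is `(f N + N')/N'`. -/
theorem hilbertSeries_smul [∀ d, FiniteDimensional K (ℳ d)] (hsmul : GradedAction 𝒜 ℳ)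
    {N N' : Submodule R M} (hN : N.IsHomogeneous ℳ) (hN' : N'.IsHomogeneous ℳ)
    {δ : Fin r → ℕ} {f : R} (hf : f ∈ 𝒜 δ) (e : Fin r → ℤ) :
    hilbertSeries ℳ N (fun i => e i - δ i) -
      hilbertSeries ℳ (N ⊓ N'.comap (f • LinearMap.id)) (fun i => e i - δ i) =
    hilbertSeries ℳ (N.map (f • LinearMap.id) ⊔ N') e - hilbertSeries ℳ N' e := by
  set d : Fin r → ℤ := fun i => e i - δ i
  have hde : (fun i => (δ i : ℤ) + d i) = e := by ext i; simp [d]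
  rw [hilbertSeries_eq_add (le_sup_right : N' ≤ N.map (f • LinearMap.id) ⊔ N') e,
    add_sub_cancel_left, sub_eq_iff_eq_add]
  have : FiniteDimensional K ↥(N.restrictScalars K ⊓ ℳ d) :=
    Submodule.finiteDimensional_of_le inf_le_right
  set g : M →ₗ[K] M ⧸ N' := (N'.mkQ ∘ₗ (f • LinearMap.id)).restrictScalars K
  have key := finrank_map_add_finrank_inf_ker g (N.restrictScalars K ⊓ ℳ d)
  have hker : LinearMap.ker g ⊓ (N.restrictScalars K ⊓ ℳ d) =
      (N ⊓ N'.comap (f • LinearMap.id)).restrictScalars K ⊓ ℳ d := by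
    ext x
    have hgx : g x = 0 ↔ f • x ∈ N' := Submodule.Quotient.mk_eq_zero N'
    simp only [Submodule.mem_inf, LinearMap.mem_ker, hgx, Submodule.restrictScalars_mem,
      Submodule.mem_comap, LinearMap.smul_apply, LinearMap.id_apply]
    tauto
  have hmap : (N.restrictScalars K ⊓ ℳ d).map g =
      ((N.map (f • LinearMap.id) ⊔ N').restrictScalars K ⊓ ℳ e).map
        (N'.mkQ.restrictScalars K) := by
    apply le_antisymm
    · rintro _ ⟨x, ⟨hx, hxd⟩, rfl⟩
      exact ⟨f • x, ⟨Submodule.mem_sup_left ⟨x, hx, rfl⟩, hde ▸ hsmul δ d f hf x hxd⟩, rfl⟩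
    · rintro _ ⟨x, ⟨hx, hxe⟩, rfl⟩
      obtain ⟨_, ⟨y, hy, rfl⟩, z, hz, rfl⟩ := Submodule.mem_sup.mp hx
      refine ⟨proj ℳ d y, ⟨hN d hy, proj_mem ℳ d y⟩, ?_⟩
      rw [← proj_of_mem ℳ hxe, map_add, LinearMap.smul_apply, LinearMap.id_apply,
        proj_smul hsmul hf]
      refine (Submodule.Quotient.eq N').mpr ?_
      have := N'.neg_mem (hN' e hz)
      rw [← proj_apply] at this
      simpa [d] using this
  rw [hker, hmap] at key
  rw [hilbertSeries, hilbertSeries, ← key]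
  push_cast
  ring

/-- The Hilbert series of `N`, divided by `t^c`. -/
noncomputable def hilbertPowerSeries (c : Fin r → ℤ) (ℳ : (Fin r → ℤ) → Submodule K M) (N : Submodule R M) :
    MvPowerSeries (Fin r) ℤ := shiftSeries c (hilbertSeries ℳ N)

theorem tpow_mul_hilbertPowerSeries_sub [∀ d, FiniteDimensional K (ℳ d)]
    (hsmul : GradedAction 𝒜 ℳ) {c : Fin r → ℤ} (hc : ∀ d, ∀ x ∈ ℳ d, x ≠ 0 → c ≤ d)
    {N N' : Submodule R M} (hN : N.IsHomogeneous ℳ) (hN' : N'.IsHomogeneous ℳ)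
    {δ : Fin r → ℕ} {f : R} (hf : f ∈ 𝒜 δ) :
    (tpow δ : MvPowerSeries (Fin r) ℤ) * (hilbertPowerSeries c ℳ N -
      hilbertPowerSeries c ℳ (N ⊓ N'.comap (f • LinearMap.id))) =
    hilbertPowerSeries c ℳ (N.map (f • LinearMap.id) ⊔ N') - hilbertPowerSeries c ℳ N' := by
  have hsub : ∀ N₁ N₂ : Submodule R M, hilbertPowerSeries c ℳ N₁ - hilbertPowerSeries c ℳ N₂ =
    shiftSeries c (hilbertSeries ℳ N₁ - hilbertSeries ℳ N₂) := fun _ _ => rfl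
  rw [hsub, hsub, ← shiftSeries_polyMul]
  · congr 1
    ext e
    rw [tpow_eq_monomial, polyMul_monomial, one_mul]
    exact hilbertSeries_smul hsmul hN hN' hf e
  · intro e he
    by_cases h : hilbertSeries ℳ N e = 0
    · refine le_of_hilbertSeries_ne_zero hc (N ⊓ N'.comap (f • LinearMap.id)) e fun h' => he ?_
      rw [Pi.sub_apply, h, h', sub_zero]
    · exact le_of_hilbertSeries_ne_zero hc _ e h

variable {ι : Type*} [Finite ι]

theorem isNoetherian_adjoin (f : ι → R) [Module.Finite (Algebra.adjoin K (Set.range f)) M] :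
    IsNoetherian (Algebra.adjoin K (Set.range f)) M := by
  have : Algebra.FiniteType K (Algebra.adjoin K (Set.range f)) :=
    (Subalgebra.fg_iff_finiteType _).mp
      (Subalgebra.fg_def.mpr ⟨_, Set.finite_range f, rfl⟩)
  have : IsNoetherianRing (Algebra.adjoin K (Set.range f)) :=
    Algebra.FiniteType.isNoetherianRing K _
  exact isNoetherian_of_isNoetherianRing_of_finite _ M

/-- The subalgebra generated by the `f i` acts on the image of `N` in `M/N'` through scalars of `K`,
so finite generation over it becomes finite dimension over `K`. This is the base case of
Hilbert–Serre. -/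
theorem exists_finset_le_span_sup {f : ι → R} [Module.Finite (Algebra.adjoin K (Set.range f)) M]
    {N N' : Submodule R M} (hN : ∀ i, ∀ x ∈ N, f i • x ∈ N') :
    ∃ T : Finset M, ∀ x ∈ N, ∃ w ∈ Submodule.span K (T : Set M), x - w ∈ N' := by
  have := isNoetherian_adjoin (K := K) (M := M) f
  obtain ⟨T, hT⟩ := IsNoetherian.noetherian (N.restrictScalars (Algebra.adjoin K (Set.range f)))
  refine ⟨T, fun x hx => ?_⟩
  have hτ : ∀ τ ∈ Algebra.adjoin K (Set.range f), ∃ k : K, ∀ y ∈ N, τ • y - k • y ∈ N' := by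
    intro τ hτ
    induction hτ using Algebra.adjoin_induction with
    | mem τ h =>
      obtain ⟨i, rfl⟩ := h
      exact ⟨0, fun y hy => by simpa using hN i y hy⟩
    | algebraMap k => exact ⟨k, fun y hy => by simp⟩
    | add a b _ _ ha hb =>
      obtain ⟨k, hk⟩ := ha
      obtain ⟨l, hl⟩ := hb
      refine ⟨k + l, fun y hy => ?_⟩
      convert N'.add_mem (hk y hy) (hl y hy) using 1
      rw [add_smul, add_smul]
      abel
    | mul a b _ _ ha hb =>
      obtain ⟨k, hk⟩ := ha
      obtain ⟨l, hl⟩ := hb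
      refine ⟨k * l, fun y hy => ?_⟩
      have h1 := N'.smul_mem a (hl y hy)
      have h2 := N'.smul_of_tower_mem l (hk y hy)
      convert N'.add_mem h1 h2 using 1
      rw [smul_sub, smul_sub, smul_comm a l y, mul_smul, ← mul_smul l k, mul_comm k l]
      abel
  have hx' : x ∈ Submodule.span (Algebra.adjoin K (Set.range f)) (T : Set M) := hT ▸ hx
  induction hx' using Submodule.span_induction with
  | mem x hx' => exact ⟨x, Submodule.subset_span hx', by simp⟩
  | zero => exact ⟨0, zero_mem _, by simp⟩
  | add x y hx' hy' ihx ihy =>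
    obtain ⟨w, hw, h⟩ := ihx (hT ▸ hx' : x ∈ N.restrictScalars (Algebra.adjoin K (Set.range f)))
    obtain ⟨w', hw', h'⟩ := ihy (hT ▸ hy' : y ∈ N.restrictScalars (Algebra.adjoin K (Set.range f)))
    refine ⟨w + w', add_mem hw hw', ?_⟩
    convert N'.add_mem h h' using 1
    abel
  | smul τ x hx' ih =>
    have hxN : x ∈ N := (hT ▸ hx' : x ∈ N.restrictScalars (Algebra.adjoin K (Set.range f)))
    obtain ⟨w, hw, h⟩ := ih hxN
    obtain ⟨k, hk⟩ := hτ τ τ.2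
    refine ⟨k • w, Submodule.smul_mem _ k hw, ?_⟩
    convert N'.add_mem (hk x hxN) (N'.smul_of_tower_mem k h) using 1
    rw [smul_sub, sub_add_sub_cancel]
    rfl

/-- The Hilbert–Serre theorem for a subquotient `N/N'` that is annihilated by the `f i`, `i ∉ S`. -/
theorem isPoly_prod_mul_hilbertPowerSeries_sub [∀ d, FiniteDimensional K (ℳ d)]
    (hsmul : GradedAction 𝒜 ℳ) {c : Fin r → ℤ} (hc : ∀ d, ∀ x ∈ ℳ d, x ≠ 0 → c ≤ d)
    {f : ι → R} {δ : ι → Fin r → ℕ} (hf : ∀ i, f i ∈ 𝒜 (δ i))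
    [Module.Finite (Algebra.adjoin K (Set.range f)) M] (S : Finset ι) {N N' : Submodule R M}
    (hN : N.IsHomogeneous ℳ) (hN' : N'.IsHomogeneous ℳ) (hle : N' ≤ N)
    (h : ∀ i ∉ S, ∀ x ∈ N, f i • x ∈ N') :
    IsPoly (((∏ i ∈ S, (1 - tpow (δ i)) : MvPolynomial (Fin r) ℤ) : MvPowerSeries (Fin r) ℤ) *
      (hilbertPowerSeries c ℳ N - hilbertPowerSeries c ℳ N')) := by
  classical
  induction S using Finset.induction_on generalizing N N' with
  | empty =>
    rw [Finset.prod_empty, MvPolynomial.coe_one, one_mul]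
    obtain ⟨T, hT⟩ := exists_finset_le_span_sup (K := K) (fun i => h i (Finset.notMem_empty i))
    have hfin : (⋃ x ∈ T, {d | proj ℳ d x ≠ 0}).Finite :=
      T.finite_toSet.biUnion fun x _ => finite_setOf_proj_ne_zero ℳ x
    refine isPoly_of_finite ((hfin.preimage (f := fun (a : Fin r →₀ ℕ) i => (a i : ℤ) + c i)
      ?_).subset ?_)
    · intro a _ b _ hab
      ext i
      simpa using congrFun hab i
    · intro a ha
      by_contra hna
      apply ha
      set d : Fin r → ℤ := fun i => (a i : ℤ) + c i with hd
      have hproj : ∀ w ∈ Submodule.span K (T : Set M), proj ℳ d w = 0 := by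
        intro w hw
        have : Submodule.span K (T : Set M) ≤ LinearMap.ker (proj ℳ d) :=
          Submodule.span_le.mpr fun x hx => by
            by_contra h0
            exact hna (Set.mem_biUnion (Finset.mem_coe.mp hx) h0)
        exact this hw
      have heq : N.restrictScalars K ⊓ ℳ d = N'.restrictScalars K ⊓ ℳ d := by
        refine le_antisymm (fun x hx => ⟨?_, hx.2⟩) (inf_le_inf_right _ hle)
        obtain ⟨w, hw, hxw⟩ := hT x hx.1
        have := hN' d hxw
        rw [← proj_apply, map_sub, hproj w hw, sub_zero, proj_of_mem ℳ hx.2] at this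
        exact this
      rw [map_sub, hilbertPowerSeries, hilbertPowerSeries, coeff_shiftSeries, coeff_shiftSeries,
        ← hd, hilbertSeries, hilbertSeries, heq, sub_self]
  | insert i S hi ih =>
    -- `h1` treats the cokernel and `h2` the kernel of multiplication by `f i` on `N/N'`. Both are
    -- killed by `f i`, so the factor for `i` is not needed there.
    have h1 := ih (N := N) (N' := N.map (f i • LinearMap.id) ⊔ N') hN
      (isHomogeneous_sup (isHomogeneous_map_smul hsmul hN (hf i)) hN')
      (sup_le (by rintro _ ⟨x, hx, rfl⟩; exact N.smul_mem _ hx) hle) fun j hj x hx => by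
        by_cases hij : j = i
        · subst hij
          exact Submodule.mem_sup_left ⟨x, hx, rfl⟩
        · exact Submodule.mem_sup_right (h j (by simp [hij, hj]) x hx)
    have h2 := ih (N := N ⊓ N'.comap (f i • LinearMap.id)) (N' := N')
      (isHomogeneous_inf_comap_smul hsmul hN hN' (hf i)) hN'
      (le_inf hle fun x hx => N'.smul_mem (f i) hx) fun j hj x hx => by
        by_cases hij : j = i
        · subst hij
          exact hx.2
        · exact h j (by simp [hij, hj]) x hx.1
    have key := tpow_mul_hilbertPowerSeries_sub hsmul hc hN hN' (hf i)
    convert h1.sub ((isPoly_coe (tpow (δ i))).mul h2) using 1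
    rw [Finset.prod_insert hi, MvPolynomial.coe_mul]
    have : ((1 - tpow (δ i) : MvPolynomial (Fin r) ℤ) : MvPowerSeries (Fin r) ℤ) = 1 - tpow (δ i) := by
      simpa using map_sub (MvPolynomial.coeToMvPowerSeries.ringHom (R := ℤ) (σ := Fin r)) 1 (tpow (δ i))
    rw [this]
    linear_combination (-((∏ i ∈ S, (1 - tpow (δ i)) : MvPolynomial (Fin r) ℤ) : MvPowerSeries (Fin r) ℤ)) * key

end HilbertSerre

/-! ### Graded prime avoidance and homogeneous parameters. -/

section Parameters

variable {K R : Type*} [Field K] [CommRing R] [Algebra K R] {r : ℕ}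
  (𝒜 : (Fin r → ℕ) → Submodule K R) [GradedAlgebra 𝒜]

/-- Multiply the given elements: the product lies in every `p` but not in the prime `q`. The factor
from `hq` keeps the multiple of `e` positive. -/
theorem exists_homogeneous_mem_notMem {e : Fin r → ℕ} {q : Ideal R} [q.IsPrime]
    (hq : ∃ k ≠ 0, ∃ u ∈ 𝒜 (k • e), u ∉ q) (s : Finset (Ideal R))
    (hs : ∀ p ∈ s, ∃ k : ℕ, ∃ u ∈ 𝒜 (k • e), u ∈ p ∧ u ∉ q) :
    ∃ k ≠ 0, ∃ g ∈ 𝒜 (k • e), g ∉ q ∧ ∀ p ∈ s, g ∈ p := by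
  classical
  induction s using Finset.induction_on with
  | empty =>
    obtain ⟨k, hk, u, hu, huq⟩ := hq
    exact ⟨k, hk, u, hu, huq, by simp⟩
  | insert p s _ ih =>
    obtain ⟨k, hk, g, hg, hgq, hgs⟩ := ih fun p hp => hs p (Finset.mem_insert_of_mem hp)
    obtain ⟨l, u, hu, hup, huq⟩ := hs p (Finset.mem_insert_self p s)
    refine ⟨k + l, by omega, g * u, ?_, ?_, fun p₁ hp₁ => ?_⟩
    · rw [add_smul]
      exact SetLike.mul_mem_graded hg hu
    · exact fun h => (Ideal.IsPrime.mem_or_mem ‹_› h).elim hgq huq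
    · rcases Finset.mem_insert.mp hp₁ with rfl | hp₁
      · exact Ideal.mul_mem_left _ _ hup
      · exact Ideal.mul_mem_right _ _ (hgs p₁ hp₁)

/-- Graded prime avoidance. -/
theorem exists_homogeneous_notMem_of_isPrime {e : Fin r → ℕ} (s : Finset (Ideal R))
    (hprime : ∀ p ∈ s, p.IsPrime) (hs : ∀ p ∈ s, ∃ k ≠ 0, ∃ u ∈ 𝒜 (k • e), u ∉ p) :
    ∃ k ≠ 0, ∃ f ∈ 𝒜 (k • e), ∀ p ∈ s, f ∉ p := by
  classical
  induction s using Finset.strongInduction with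
  | H s ih =>
  rcases s.eq_empty_or_nonempty with rfl | ⟨q, hq⟩
  · exact ⟨1, one_ne_zero, 0, zero_mem _, by simp⟩
  have := hprime q hq
  -- If the elements of `p` with degree in `ℕ e` all lie in `q`, then avoiding `q` already avoids
  -- `p`, and `p` can be dropped.
  by_cases hcomp : ∃ p ∈ s.erase q, ∀ k : ℕ, ∀ x ∈ 𝒜 (k • e), x ∈ p → x ∈ q
  · obtain ⟨p, hp, hpq⟩ := hcomp
    have hps := Finset.mem_of_mem_erase hp
    obtain ⟨k, hk, f, hf, hfs⟩ := ih (s.erase p) (Finset.erase_ssubset hps)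
      (fun p' hp' => hprime p' (Finset.mem_of_mem_erase hp'))
      fun p' hp' => hs p' (Finset.mem_of_mem_erase hp')
    refine ⟨k, hk, f, hf, fun p' hp' => ?_⟩
    by_cases h : p' = p
    · subst h
      exact fun hfp => hfs q (Finset.mem_erase.mpr ⟨(Finset.ne_of_mem_erase hp).symm, hq⟩)
        (hpq k f hf hfp)
    · exact hfs p' (Finset.mem_erase.mpr ⟨h, hp'⟩)
  · push Not at hcomp
    obtain ⟨k, hk, f, hf, hfs⟩ := ih (s.erase q) (Finset.erase_ssubset hq)
      (fun p' hp' => hprime p' (Finset.mem_of_mem_erase hp'))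
      fun p' hp' => hs p' (Finset.mem_of_mem_erase hp')
    by_cases hfq : f ∈ q
    · obtain ⟨l, hl, g, hg, hgq, hgs⟩ := exists_homogeneous_mem_notMem 𝒜 (hs q hq) (s.erase q) hcomp
      -- Both powers have degree `(l * k) • e`. At each prime exactly one of `f`, `g` is a member,
      -- so the sum avoids all of them.
      refine ⟨l * k, mul_ne_zero hl hk, f ^ l + g ^ k, ?_, fun p hp h => ?_⟩
      · refine add_mem ?_ ?_
        · rw [mul_smul]; exact SetLike.pow_mem_graded l hf
        · rw [mul_comm, mul_smul]; exact SetLike.pow_mem_graded k hg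
      · have hpp := hprime p hp
        by_cases hpq : p = q
        · subst hpq
          exact hgq (hpp.mem_of_pow_mem k
            ((Ideal.add_mem_iff_right p (Ideal.pow_mem_of_mem p hfq l (Nat.pos_of_ne_zero hl))).mp h))
        · have hp' := Finset.mem_erase.mpr ⟨hpq, hp⟩
          exact hfs p hp' (hpp.mem_of_pow_mem l
            ((Ideal.add_mem_iff_left p (Ideal.pow_mem_of_mem p (hgs p hp') k
              (Nat.pos_of_ne_zero hk))).mp h))
    · refine ⟨k, hk, f, hf, fun p hp => ?_⟩
      by_cases hpq : p = q
      · exact hpq ▸ hfq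
      · exact hfs p (Finset.mem_erase.mpr ⟨hpq, hp⟩)

theorem finite_quotient_of_le [FiniteDimensional K (𝒜 0)] {B : Ideal R}
    (hB : ∀ d ≠ 0, ∀ x ∈ 𝒜 d, x ∈ B) : Module.Finite K (R ⧸ B) := by
  refine Module.Finite.of_surjective ((Ideal.Quotient.mkₐ K B).toLinearMap ∘ₗ (𝒜 0).subtype)
    fun y => ?_
  obtain ⟨x, rfl⟩ := Ideal.Quotient.mk_surjective y
  induction x using DirectSum.Decomposition.inductionOn 𝒜 with
  | zero => exact ⟨0, by simp⟩
  | @homogeneous d x =>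
    by_cases hd : d = 0
    · subst hd
      exact ⟨x, rfl⟩
    · exact ⟨0, by simpa using (Ideal.Quotient.eq_zero_iff_mem.mpr (hB d hd x x.2)).symm⟩
  | add x y hx hy =>
    obtain ⟨a, ha⟩ := hx
    obtain ⟨b, hb⟩ := hy
    exact ⟨a + b, by rw [map_add, ha, hb, map_add]⟩

theorem isMaximal_of_finite_quotient {p : Ideal R} [p.IsPrime] [Module.Finite K (R ⧸ p)] :
    p.IsMaximal := by
  have : IsArtinianRing (R ⧸ p) := IsArtinianRing.of_finite K _
  exact Ideal.Quotient.maximal_of_isField p (IsArtinianRing.isField_of_isDomain _)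

theorem mem_idealI {d e : Fin r → ℕ} (h : ¬ VecDvd e d) {x : R} (hx : x ∈ 𝒜 d) : x ∈ idealI 𝒜 e :=
  Ideal.subset_span ⟨d, h, hx⟩

/-- A chain of primes over `𝔞 + (f)` starts above a minimal prime `p` of `𝔞`. If it starts strictly
above, adjoining `p` lengthens it. If it starts at `p`, then `f ∈ p` forces `p` to contain
everything of nonzero degree; then `p` is maximal and the chain has length `0`. -/
theorem ringKrullDim_quotient_sup_span_le [FiniteDimensional K (𝒜 0)] {e : Fin r → ℕ} {𝔞 : Ideal R}
    (h𝔞 : idealI 𝒜 e ≤ 𝔞) {m : ℕ} (hm : ringKrullDim (R ⧸ 𝔞) ≤ (m + 1 : ℕ)) {f : R}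
    (hf : ∀ p ∈ 𝔞.minimalPrimes, (∃ k ≠ 0, ∃ u ∈ 𝒜 (k • e), u ∉ p) → f ∉ p) :
    ringKrullDim (R ⧸ (𝔞 ⊔ Ideal.span {f})) ≤ m := by
  rw [ringKrullDim_quotient] at hm ⊢
  refine iSup_le fun l => ?_
  have hl : 𝔞 ⊔ Ideal.span {f} ≤ l.head.1.asIdeal := l.head.2
  have := l.head.1.isPrime
  obtain ⟨p, hp, hpl⟩ := Ideal.exists_minimalPrimes_le (le_sup_left.trans hl)
  have hpp : p.IsPrime := hp.1.1
  have hle : PrimeSpectrum.zeroLocus ((𝔞 ⊔ Ideal.span {f} : Ideal R) : Set R) ⊆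
      PrimeSpectrum.zeroLocus (𝔞 : Set R) := PrimeSpectrum.zeroLocus_anti_mono_ideal le_sup_left
  let p' : PrimeSpectrum.zeroLocus (𝔞 : Set R) := ⟨⟨p, hpp⟩, hp.1.2⟩
  rcases hpl.lt_or_eq with hlt | heq
  · let l' : LTSeries (PrimeSpectrum.zeroLocus (𝔞 : Set R)) :=
      l.map (Set.inclusion hle) fun _ _ h => h
    have hlen : (l'.cons p' hlt).length = l.length + 1 := RelSeries.cons_length l' p' hlt
    have h := (Order.LTSeries.length_le_krullDim (l'.cons p' hlt)).trans hm
    rw [hlen] at h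
    have h' : l.length + 1 ≤ m + 1 := by exact_mod_cast h
    exact_mod_cast Nat.le_of_succ_le_succ h'
  · have hfp : f ∈ p := heq ▸ hl (Submodule.mem_sup_right (Ideal.mem_span_singleton_self f))
    have hall : ∀ d ≠ 0, ∀ x ∈ 𝒜 d, x ∈ p := by
      intro d hd x hx
      by_cases hed : VecDvd e d
      · obtain ⟨k, rfl⟩ := hed
        by_contra hxp
        exact hf p hp ⟨k, fun hk => hd (by simp [hk]), x, hx, hxp⟩ hfp
      · exact hp.1.2 (h𝔞 (mem_idealI 𝒜 hed hx))
    have := finite_quotient_of_le 𝒜 hall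
    have hmax : p.IsMaximal := isMaximal_of_finite_quotient (K := K)
    have : l.length = 0 := by
      by_contra h0
      have hlt : l.head < l.last := l.strictMono (Fin.pos_iff_ne_zero.mpr fun h => h0 (by simpa using h))
      have hlt' : p < l.last.1.asIdeal := heq ▸ hlt
      exact l.last.1.isPrime.ne_top (hmax.1.2 _ hlt')
    rw [this]
    exact_mod_cast Nat.zero_le m

/-- Existence of homogeneous systems of parameters. -/
theorem exists_parameters [Algebra.FiniteType K R] [FiniteDimensional K (𝒜 0)] {e : Fin r → ℕ}
    (m : ℕ) {𝔞 : Ideal R} (h𝔞 : idealI 𝒜 e ≤ 𝔞) (hm : ringKrullDim (R ⧸ 𝔞) ≤ m) :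
    ∃ (f : Fin m → R) (k : Fin m → ℕ), (∀ i, k i ≠ 0) ∧ (∀ i, f i ∈ 𝒜 (k i • e)) ∧
      Module.Finite K (R ⧸ (𝔞 ⊔ Ideal.span (Set.range f))) := by
  induction m generalizing 𝔞 with
  | zero =>
    refine ⟨Fin.elim0, Fin.elim0, fun i => i.elim0, fun i => i.elim0, ?_⟩
    rw [Set.range_eq_empty, Ideal.span_empty, sup_bot_eq, Module.finite_iff_krullDimLE_zero,
      Ring.KrullDimLE, Order.krullDimLE_iff]
    exact hm
  | succ m ih =>
    classical
    have : IsNoetherianRing R := Algebra.FiniteType.isNoetherianRing K R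
    have hfin : 𝔞.minimalPrimes.Finite := Ideal.finite_minimalPrimes_of_isNoetherianRing R 𝔞
    obtain ⟨k, hk, f, hf, hfp⟩ := exists_homogeneous_notMem_of_isPrime 𝒜 (e := e)
      (hfin.toFinset.filter fun p => ∃ k ≠ 0, ∃ u ∈ 𝒜 (k • e), u ∉ p)
      (fun p hp => (hfin.mem_toFinset.mp (Finset.mem_filter.mp hp).1).1.1)
      fun p hp => (Finset.mem_filter.mp hp).2
    have hdim := ringKrullDim_quotient_sup_span_le 𝒜 h𝔞 hm (f := f) fun p hp h =>
      hfp p (Finset.mem_filter.mpr ⟨hfin.mem_toFinset.mpr hp, h⟩)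
    obtain ⟨f', k', hk', hf', hfinite⟩ := ih (h𝔞.trans le_sup_left) hdim
    refine ⟨Fin.cons f f', Fin.cons k k', Fin.cases hk hk', Fin.cases hf hf', ?_⟩
    rwa [Fin.range_cons, Ideal.span_insert, ← sup_assoc]

end Parameters

/-! ### Systems of parameters adapted to `e`, and finiteness of the exponents. -/

section Systems

variable {K R M : Type*} [Field K] [CommRing R] [Algebra K R] [AddCommGroup M] [Module K M]
  [Module R M] [IsScalarTower K R M] {r : ℕ}
  (𝒜 : (Fin r → ℕ) → Submodule K R) [GradedAlgebra 𝒜]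

theorem suppDim_eq [Module.Finite R M] (e : Fin r → ℕ) :
    suppDim 𝒜 M e = ringKrullDim (R ⧸ (Module.annihilator R M ⊔ idealI 𝒜 e)) := by
  rw [ringKrullDim_quotient, suppDim, Module.supportDim, Module.support_quotient,
    Module.support_eq_zeroLocus, ← PrimeSpectrum.zeroLocus_sup]

theorem suppDim_ne_top [Algebra.FiniteType K R] (e : Fin r → ℕ) : suppDim 𝒜 M e ≠ ⊤ := by
  obtain ⟨n, g, hg⟩ := Algebra.FiniteType.iff_quotient_mvPolynomial''.mp
    (inferInstance : Algebra.FiniteType K R)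
  have h1 : suppDim 𝒜 M e ≤ ringKrullDim R := Module.supportDim_le_ringKrullDim R _
  have h2 := ringKrullDim_le_of_surjective g.toRingHom hg
  have h3 := MvPolynomial.ringKrullDim_of_isNoetherianRing (R := K) (ι := Fin n)
  have h4 : suppDim 𝒜 M e ≤ (n : WithBot ℕ∞) := by
    refine (h1.trans h2).trans (h3.le.trans ?_)
    simp [ringKrullDim_eq_zero_of_field]
  intro h
  rw [h] at h4
  exact absurd (WithBot.coe_le_coe.mp h4 : (⊤ : ℕ∞) ≤ n) (by simp)

/-- Only an inequality, since an empty support has dimension `⊥` but exponent `0`. -/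
theorem suppDim_le_mult [Algebra.FiniteType K R] (e : Fin r → ℕ) :
    suppDim 𝒜 M e ≤ (mult 𝒜 M e : WithBot ℕ∞) := by
  have h := suppDim_ne_top 𝒜 (M := M) e
  rw [mult]
  cases hs : suppDim 𝒜 M e using WithBot.recBotCoe with
  | bot => exact bot_le
  | coe n =>
    have hn : n ≠ ⊤ := by rintro rfl; exact h hs
    rw [WithBot.unbotD_coe]
    have := ENat.natCast_toNat hn
    exact (congrArg (WithBot.some) this).ge

theorem suppDim_eq_mult [Algebra.FiniteType K R] {e : Fin r → ℕ} (h : mult 𝒜 M e ≠ 0) :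
    suppDim 𝒜 M e = (mult 𝒜 M e : WithBot ℕ∞) := by
  have h' := suppDim_ne_top 𝒜 (M := M) e
  rw [mult] at h ⊢
  cases hs : suppDim 𝒜 M e using WithBot.recBotCoe with
  | bot => simp [hs] at h
  | coe n =>
    have hn : n ≠ ⊤ := by rintro rfl; exact h' hs
    rw [WithBot.unbotD_coe]
    exact (congrArg (WithBot.some) (ENat.natCast_toNat hn)).symm

theorem exists_finset_span_idealI [IsNoetherianRing R] (e : Fin r → ℕ) :
    ∃ G : Finset R, (∀ x ∈ G, ∃ d, ¬ VecDvd e d ∧ x ∈ 𝒜 d) ∧ Ideal.span (G : Set R) = idealI 𝒜 e := by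
  obtain ⟨G, hG, hspan⟩ := Submodule.fg_span_iff_fg_span_finset_subset _ |>.mp
    (IsNoetherian.noetherian (idealI 𝒜 e))
  exact ⟨G, fun x hx => hG hx, hspan.symm⟩

/-- A system of parameters of `M` in which at most `m_e` of the degrees are divisible by `e`. -/
theorem exists_system [Algebra.FiniteType K R] [FiniteDimensional K (𝒜 0)] [Module.Finite R M]
    (e : Fin r → ℕ) :
    ∃ (G : Finset R) (f : Fin (mult 𝒜 M e) → R) (k : Fin (mult 𝒜 M e) → ℕ) (η : G → Fin r → ℕ),
      (∀ i, k i ≠ 0) ∧ (∀ i, f i ∈ 𝒜 (k i • e)) ∧ (∀ g, ¬ VecDvd e (η g)) ∧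
      (∀ g : G, (g : R) ∈ 𝒜 (η g)) ∧
      Module.Finite K (R ⧸ (Module.annihilator R M ⊔
        Ideal.span (Set.range (Sum.elim f ((↑) : G → R))))) := by
  have : IsNoetherianRing R := Algebra.FiniteType.isNoetherianRing K R
  obtain ⟨G, hG, hspan⟩ := exists_finset_span_idealI 𝒜 e
  choose! η hη hGη using hG
  obtain ⟨f, k, hk, hf, hfin⟩ := exists_parameters 𝒜 (e := e) (mult 𝒜 M e) le_sup_right
    ((suppDim_eq 𝒜 (M := M) e).symm.le.trans (suppDim_le_mult 𝒜 e))
  refine ⟨G, f, k, fun g => η g, hk, hf, fun g => hη g g.2, fun g => hGη g g.2, ?_⟩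
  rwa [Set.Sum.elim_range, Ideal.span_union, Subtype.range_coe_subtype, Finset.setOfPred_mem, hspan,
    sup_comm (Ideal.span _), ← sup_assoc]

/-- This makes `idealI 𝒜 0` the irrelevant ideal. -/
theorem vecDvd_zero_iff {d : Fin r → ℕ} : VecDvd 0 d ↔ d = 0 := by simp [VecDvd]

/-- Homogeneous generators of the irrelevant ideal form a system of parameters of `M`. -/
theorem exists_irrelevant_system [Algebra.FiniteType K R] [FiniteDimensional K (𝒜 0)] :
    ∃ (G : Finset R) (η : G → Fin r → ℕ), (∀ g, η g ≠ 0) ∧ (∀ g : G, (g : R) ∈ 𝒜 (η g)) ∧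
      ∀ B : Ideal R, Ideal.span (Set.range ((↑) : G → R)) ≤ B → Module.Finite K (R ⧸ B) := by
  have : IsNoetherianRing R := Algebra.FiniteType.isNoetherianRing K R
  obtain ⟨G, hG, hspan⟩ := exists_finset_span_idealI 𝒜 0
  choose! η hη hGη using hG
  refine ⟨G, fun g => η g, fun g => fun h => hη g g.2 (vecDvd_zero_iff.mpr h),
    fun g => hGη g g.2, fun B hB => finite_quotient_of_le 𝒜 fun d hd x hx => hB ?_⟩
  rw [Subtype.range_coe_subtype, Finset.setOfPred_mem, hspan]
  exact mem_idealI 𝒜 (fun h => hd (vecDvd_zero_iff.mp h)) hx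

/-- If `e` divides none of the degrees of the irrelevant generators, then `I^{[e]}` contains them
all and the exponent vanishes. The finitely many nonzero degrees have finitely many divisors. -/
theorem finite_setOf_mult_ne_zero [Algebra.FiniteType K R] [FiniteDimensional K (𝒜 0)]
    [Module.Finite R M] : {e | mult 𝒜 M e ≠ 0}.Finite := by
  obtain ⟨G, η, hη, hG, hfin⟩ := exists_irrelevant_system 𝒜
  refine (Set.finite_iUnion fun g : G => finite_setOf_vecDvd (hη g)).subset fun e he => ?_
  by_contra hne
  apply he
  have : Module.Finite K (R ⧸ (Module.annihilator R M ⊔ idealI 𝒜 e)) := by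
    refine hfin _ (le_sup_of_le_right (Ideal.span_le.mpr ?_))
    rintro _ ⟨g, rfl⟩
    exact mem_idealI 𝒜 (fun h => hne (Set.mem_iUnion.mpr ⟨g, h⟩)) (hG g)
  rw [Module.finite_iff_krullDimLE_zero, Ring.KrullDimLE, Order.krullDimLE_iff] at this
  have h0 : suppDim 𝒜 M e ≤ (0 : ℕ) := (suppDim_eq 𝒜 e).trans_le this
  by_contra hm
  rw [suppDim_eq_mult 𝒜 hm] at h0
  exact hm (Nat.le_zero.mp (by exact_mod_cast h0))

end Systems

/-! ### Growth of coefficients and order of the pole at `1`. -/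

section Growth

open PowerSeries

theorem coeff_eq_sum_coeff_one_sub_X_mul (G : ℤ⟦X⟧) (n : ℕ) :
    coeff n G = ∑ k ∈ Finset.range (n + 1), coeff k ((1 - X) * G) := by
  induction n with
  | zero => simp [sub_mul]
  | succ n ih =>
    rw [Finset.sum_range_succ, ← ih, sub_mul, one_mul, map_sub, coeff_succ_X_mul]
    ring

/-- Dividing by `1 - X` takes partial sums of coefficients, which raises the growth exponent by at
most one. -/
theorem exists_abs_coeff_le (m : ℕ) {G : ℤ⟦X⟧} {P : Polynomial ℤ}
    (h : (1 - X) ^ (m + 1) * G = (P : ℤ⟦X⟧)) :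
    ∃ C : ℕ, ∀ n, |coeff n G| ≤ C * (n + 1) ^ m := by
  induction m generalizing G with
  | zero =>
    refine ⟨∑ k ∈ P.support, (P.coeff k).natAbs, fun n => ?_⟩
    rw [coeff_eq_sum_coeff_one_sub_X_mul, ← pow_one (1 - X : ℤ⟦X⟧), ← zero_add 1, h]
    simp only [Polynomial.coeff_coe, pow_zero, mul_one]
    refine (Finset.abs_sum_le_sum_abs _ _).trans ?_
    rw [Nat.cast_sum]
    simp only [Int.natCast_natAbs]
    rw [← Finset.sum_filter_of_ne (p := fun k => k ∈ P.support)]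
    · exact Finset.sum_le_sum_of_subset_of_nonneg
        (fun k hk => (Finset.mem_filter.mp hk).2) fun _ _ _ => abs_nonneg _
    · intro k _ hk
      simpa using hk
  | succ m ih =>
    obtain ⟨C, hC⟩ := ih (G := (1 - X) * G) (by rw [← h]; ring)
    refine ⟨C, fun n => ?_⟩
    rw [coeff_eq_sum_coeff_one_sub_X_mul]
    refine (Finset.abs_sum_le_sum_abs _ _).trans
      ((Finset.sum_le_card_nsmul _ _ ((C : ℤ) * (n + 1) ^ m) fun k hk => (hC k).trans ?_).trans ?_)
    · have : (k : ℤ) ≤ n := by exact_mod_cast Nat.lt_succ_iff.mp (Finset.mem_range.mp hk)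
      gcongr
    · rw [Finset.card_range, nsmul_eq_mul]
      push_cast
      exact le_of_eq (by ring)

/-- Each geometric sum has nonnegative coefficients and, as `a i ≠ 0`, constant term `1`;
multiplying a nonnegative series by it lowers no coefficient. -/
theorem coeff_le_coeff_prod_geom_mul {ι : Type*} (S : Finset ι) {a : ι → ℕ} (ha : ∀ i, a i ≠ 0)
    {h : ℤ⟦X⟧} (hh : ∀ k, 0 ≤ coeff k h) (k : ℕ) :
    coeff k h ≤ coeff k ((∏ i ∈ S, ∑ j ∈ Finset.range (a i), (X : ℤ⟦X⟧) ^ j) * h) := by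
  classical
  induction S using Finset.induction_on generalizing k with
  | empty => simp
  | insert i S hi ih =>
    refine (ih k).trans ?_
    rw [Finset.prod_insert hi, mul_assoc]
    set h' := (∏ i ∈ S, ∑ j ∈ Finset.range (a i), (X : ℤ⟦X⟧) ^ j) * h
    have hh' : ∀ k, 0 ≤ coeff k h' := fun k => (hh k).trans (ih k)
    rw [Finset.sum_mul, map_sum]
    have h0 := Finset.single_le_sum (s := Finset.range (a i))
      (f := fun j => coeff k ((X : ℤ⟦X⟧) ^ j * h')) (fun j _ => by
        simp only [coeff_X_pow_mul']
        split_ifs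
        · exact hh' _
        · rfl) (Finset.mem_range.mpr (Nat.pos_of_ne_zero (ha i)))
    simpa using h0

/-- A series `P / ∏ (1 - X^{a_i})` with `m` factors whose partial sums grow like `n^m` has a pole
of order `m` at `1`. -/
theorem eval_one_ne_zero_of_growth {m : ℕ} (hm : m ≠ 0) {a : Fin m → ℕ} (ha : ∀ i, a i ≠ 0)
    {h : ℤ⟦X⟧} (hh : ∀ k, 0 ≤ coeff k h) {P : Polynomial ℤ}
    (hP : ((∏ i, (1 - Polynomial.X ^ a i) : Polynomial ℤ) : ℤ⟦X⟧) * h = P) (A : ℕ)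
    (hA : ∀ n : ℕ, ((n : ℤ) + 1) ^ m ≤ ∑ k ∈ Finset.range (A * n + 1), coeff k h) :
    P.eval 1 ≠ 0 := by
  intro hP1
  obtain ⟨m, rfl⟩ := Nat.exists_eq_succ_of_ne_zero hm
  -- A zero of `P` at `1` cancels one factor `1 - X`, so the partial sums `G` of `Q h` grow only
  -- like `n^m`, with `m` now one less than the number of factors.
  obtain ⟨P', hP'⟩ : 1 - Polynomial.X ∣ P := by
    rw [← neg_sub, neg_dvd]
    simpa using Polynomial.dvd_iff_isRoot.mpr hP1
  set Q : ℤ⟦X⟧ := ∏ i, ∑ j ∈ Finset.range (a i), (X : ℤ⟦X⟧) ^ j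
  have h1X : (1 - X : ℤ⟦X⟧) ≠ 0 := fun h0 => by
    have := congrArg constantCoeff h0
    simp at this
  have hcoe : ∀ p q : Polynomial ℤ, ((p - q : Polynomial ℤ) : ℤ⟦X⟧) = p - q := fun p q =>
    map_sub (Polynomial.coeToPowerSeries.ringHom (R := ℤ)) p q
  have hprod : ((∏ i, (1 - Polynomial.X ^ a i) : Polynomial ℤ) : ℤ⟦X⟧) = (1 - X) ^ (m + 1) * Q := by
    have : ((∏ i, (1 - Polynomial.X ^ a i) : Polynomial ℤ) : ℤ⟦X⟧) =
        ∏ i, (1 - (X : ℤ⟦X⟧) ^ a i) := by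
      rw [← Polynomial.coeToPowerSeries.ringHom_apply, map_prod]
      simp
    rw [this]
    simp only [← mul_neg_geom_sum (X : ℤ⟦X⟧)]
    rw [Finset.prod_mul_distrib, Finset.prod_const, Finset.card_univ, Fintype.card_fin]
  have hdiv : (1 - X) ^ m * (Q * h) = (P' : ℤ⟦X⟧) := by
    apply mul_left_cancel₀ h1X
    calc _ = (1 - X) ^ (m + 1) * Q * h := by ring
      _ = _ := by rw [← hprod, hP, hP', Polynomial.coe_mul, hcoe]; simp
  set G : ℤ⟦X⟧ := PowerSeries.mk 1 * (Q * h)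
  have hG1 : (1 - X) * G = Q * h := by
    rw [← mul_assoc, mul_comm (1 - X), PowerSeries.mk_one_mul_one_sub_eq_one, one_mul]
  obtain ⟨C, hC⟩ := exists_abs_coeff_le m (G := G) (P := P') (by rw [pow_succ, mul_assoc, hG1, hdiv])
  have hlow : ∀ n : ℕ, ((n : ℤ) + 1) ^ (m + 1) ≤ coeff (A * n) G := fun n => by
    refine (hA n).trans ?_
    rw [coeff_eq_sum_coeff_one_sub_X_mul, hG1]
    exact Finset.sum_le_sum fun k _ => coeff_le_coeff_prod_geom_mul _ ha hh k
  -- Chosen so that the upper bound `C (A n + 1)^m` is at most `n (n + 1)^m`, below the lower bound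
  -- `(n + 1)^(m + 1)`.
  set n : ℕ := C * (A + 1) ^ m with hn
  have h1 := (hlow n).trans ((le_abs_self _).trans (hC (A * n)))
  have h2 : ((A * n : ℕ) : ℤ) + 1 ≤ (A + 1) * (n + 1) := by push_cast; nlinarith
  have h3 : ((n : ℤ) + 1) ^ (m + 1) ≤ n * (n + 1) ^ m := by
    refine h1.trans ?_
    calc (C : ℤ) * (((A * n : ℕ) : ℤ) + 1) ^ m ≤ C * ((A + 1) * (n + 1)) ^ m := by gcongr
      _ = n * (n + 1) ^ m := by rw [mul_pow, hn]; push_cast; ring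
  rw [pow_succ, mul_comm] at h3
  have h4 : (0 : ℤ) < ((n : ℤ) + 1) ^ m := by positivity
  have := le_of_mul_le_mul_right h3 h4
  linarith

end Growth

/-! ### Series supported on a ray. -/

section Ray

variable {r : ℕ}

/-- The coefficients of `F` are supported on the ray `α + ℕ e`. -/
def SupportedOnRay (α e : Fin r → ℕ) (F : MvPowerSeries (Fin r) ℤ) : Prop :=
  ∀ a, MvPowerSeries.coeff a F ≠ 0 → ∃ k : ℕ, a = Finsupp.equivFunOnFinite.symm (α + k • e)

/-- The one-variable series of the coefficients of `F` on the ray `α + ℕ e`. -/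
noncomputable def raySeries (α e : Fin r → ℕ) (F : MvPowerSeries (Fin r) ℤ) : PowerSeries ℤ :=
  PowerSeries.mk fun k => MvPowerSeries.coeff (Finsupp.equivFunOnFinite.symm (α + k • e)) F

variable {α e : Fin r → ℕ} {F : MvPowerSeries (Fin r) ℤ}

theorem coeff_tpow_mul (e : Fin r → ℕ) (F : MvPowerSeries (Fin r) ℤ) (a : Fin r →₀ ℕ) :
    MvPowerSeries.coeff a ((tpow e : MvPowerSeries (Fin r) ℤ) * F) =
      if Finsupp.equivFunOnFinite.symm e ≤ a then MvPowerSeries.coeff (a - Finsupp.equivFunOnFinite.symm e) F else 0 := by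
  rw [tpow_eq_monomial, MvPolynomial.coe_monomial, MvPowerSeries.coeff_monomial_mul]
  simp only [one_mul]

theorem SupportedOnRay.tpow_mul (hF : SupportedOnRay α e F) :
    SupportedOnRay α e ((tpow e : MvPowerSeries (Fin r) ℤ) * F) := by
  intro a ha
  rw [coeff_tpow_mul] at ha
  split_ifs at ha with h
  · obtain ⟨k, hk⟩ := hF _ ha
    refine ⟨k + 1, ?_⟩
    ext i
    have h1 : a i - e i = α i + k * e i := by simpa using DFunLike.congr_fun hk i
    have h2 : e i ≤ a i := h i
    show a i = α i + (k + 1) * e i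
    rw [add_mul, one_mul]
    omega
  · exact absurd rfl ha

/-- The support condition matters at index `0`: the exponent `α - e`, if it is nonnegative, lies off
the ray, so its coefficient vanishes. -/
theorem raySeries_tpow_mul (he : e ≠ 0) (hF : SupportedOnRay α e F) :
    raySeries α e ((tpow e : MvPowerSeries (Fin r) ℤ) * F) = PowerSeries.X * raySeries α e F := by
  ext k
  rw [raySeries, PowerSeries.coeff_mk, coeff_tpow_mul]
  cases k with
  | zero =>
    rw [PowerSeries.coeff_zero_X_mul]
    split_ifs with h
    · by_contra h0
      obtain ⟨k, hk⟩ := hF _ h0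
      obtain ⟨i, hi⟩ := Function.ne_iff.mp he
      have h1 : α i + 0 * e i - e i = α i + k * e i := by simpa using DFunLike.congr_fun hk i
      have h2 : e i ≤ α i + 0 * e i := h i
      have h3 : 0 < e i := Nat.pos_of_ne_zero hi
      omega
    · rfl
  | succ k =>
    rw [PowerSeries.coeff_succ_X_mul, raySeries, PowerSeries.coeff_mk, if_pos]
    · congr 2
      ext i
      show α i + (k + 1) * e i - e i = α i + k * e i
      rw [add_mul, one_mul]
      omega
    · intro i
      show e i ≤ α i + (k + 1) * e i
      rw [add_mul, one_mul]
      omega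

theorem raySeries_aeval_mul (he : e ≠ 0) (hF : SupportedOnRay α e F) (q : Polynomial ℤ) :
    SupportedOnRay α e (((Polynomial.aeval (tpow e) q : MvPolynomial (Fin r) ℤ) :
      MvPowerSeries (Fin r) ℤ) * F) ∧
    raySeries α e (((Polynomial.aeval (tpow e) q : MvPolynomial (Fin r) ℤ) :
      MvPowerSeries (Fin r) ℤ) * F) = (q : PowerSeries ℤ) * raySeries α e F := by
  induction q using Polynomial.induction_on with
  | C a =>
    have hC : ((Polynomial.aeval (tpow e) (Polynomial.C a) : MvPolynomial (Fin r) ℤ) :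
      MvPowerSeries (Fin r) ℤ) = MvPowerSeries.C a := by
      rw [Polynomial.aeval_C, MvPolynomial.algebraMap_eq, MvPolynomial.coe_C]
    rw [hC]
    refine ⟨fun b hb => hF b ?_, ?_⟩
    · rw [MvPowerSeries.coeff_C_mul] at hb
      exact right_ne_zero_of_mul hb
    · ext k
      rw [raySeries, PowerSeries.coeff_mk, MvPowerSeries.coeff_C_mul, Polynomial.coe_C,
        PowerSeries.coeff_C_mul, raySeries, PowerSeries.coeff_mk]
  | add p q hp hq =>
    rw [map_add, MvPolynomial.coe_add, add_mul, Polynomial.coe_add, add_mul]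
    refine ⟨fun b hb => ?_, ?_⟩
    · rw [map_add] at hb
      by_cases h : MvPowerSeries.coeff b (((Polynomial.aeval (tpow e) p : MvPolynomial (Fin r) ℤ) :
        MvPowerSeries (Fin r) ℤ) * F) = 0
      · exact hq.1 b fun h' => hb (by rw [h, h', add_zero])
      · exact hp.1 b h
    · rw [← hp.2, ← hq.2]
      ext k
      simp only [raySeries, PowerSeries.coeff_mk, map_add]
  | monomial n a ih =>
    have h1 : Polynomial.C a * Polynomial.X ^ (n + 1) =
      Polynomial.X * (Polynomial.C a * Polynomial.X ^ n) := by ring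
    rw [h1, map_mul, Polynomial.aeval_X, MvPolynomial.coe_mul, mul_assoc]
    refine ⟨ih.1.tpow_mul, ?_⟩
    rw [raySeries_tpow_mul he ih.1, ih.2, Polynomial.coe_mul Polynomial.X, Polynomial.coe_X, mul_assoc]

theorem exists_eq_tpow_mul_aeval {p : MvPolynomial (Fin r) ℤ}
    (hp : SupportedOnRay α e (p : MvPowerSeries (Fin r) ℤ)) :
    ∃ P : Polynomial ℤ, p = tpow α * Polynomial.aeval (tpow e) P := by
  have : ∀ a ∈ p.support, ∃ P : Polynomial ℤ,
      MvPolynomial.monomial a (p.coeff a) = tpow α * Polynomial.aeval (tpow e) P := by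
    intro a ha
    obtain ⟨k, hk⟩ := hp a (by simpa using ha)
    refine ⟨Polynomial.C (p.coeff a) * Polynomial.X ^ k, ?_⟩
    conv_lhs => rw [← mul_one (p.coeff a), ← MvPolynomial.C_mul_monomial, hk, ← tpow_eq_monomial]
    rw [tpow_add, tpow_nsmul, map_mul, Polynomial.aeval_C, map_pow, Polynomial.aeval_X,
      MvPolynomial.algebraMap_eq, hk]
    ring
  choose! P hP using this
  refine ⟨∑ a ∈ p.support, P a, ?_⟩
  rw [map_sum, Finset.mul_sum, ← Finset.sum_congr rfl hP, MvPolynomial.support_sum_monomial_coeff]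

theorem supportedOnRay_tpow : SupportedOnRay α e (tpow α : MvPowerSeries (Fin r) ℤ) := by
  classical
  intro a ha
  rw [tpow_eq_monomial, MvPolynomial.coe_monomial, MvPowerSeries.coeff_monomial] at ha
  exact ⟨0, by simpa using ha⟩

theorem raySeries_tpow (he : e ≠ 0) :
    raySeries α e (tpow α : MvPowerSeries (Fin r) ℤ) = 1 := by
  classical
  ext k
  rw [raySeries, PowerSeries.coeff_mk, tpow_eq_monomial, MvPolynomial.coe_monomial,
    MvPowerSeries.coeff_monomial, PowerSeries.coeff_one]
  refine if_congr ?_ rfl rfl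
  rw [Finsupp.equivFunOnFinite.symm.injective.eq_iff, add_eq_left]
  constructor
  · intro h
    obtain ⟨i, hi⟩ := Function.ne_iff.mp he
    have := congrFun h i
    simpa [show e i ≠ 0 from hi] using this
  · rintro rfl
    simp

/-- Modulo `φ_e` one has `t^e = 1`, so `P(t^e)` becomes the nonzero integer `P(1)`. -/
theorem isRelPrime_phiVec_aeval (he : e ≠ 0) {P : Polynomial ℤ} (hP : P.eval 1 ≠ 0) :
    IsRelPrime (phiVec e) (Polynomial.aeval (tpow e) P) := by
  obtain ⟨S, hS⟩ := phiVec_dvd_one_sub_tpow he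
  obtain ⟨Q, hQ⟩ : Polynomial.X - Polynomial.C 1 ∣ P - Polynomial.C (P.eval 1) :=
    Polynomial.X_sub_C_dvd_sub_C_eval
  refine isRelPrime_of_combination (constantCoeff_phiVec e) hP
    (a := S * Polynomial.aeval (tpow e) Q) (b := 1) ?_
  have h := congrArg (Polynomial.aeval (tpow e)) hQ
  rw [map_sub, map_mul, map_sub, Polynomial.aeval_X, Polynomial.aeval_C, Polynomial.aeval_C,
    MvPolynomial.algebraMap_eq, map_one] at h
  linear_combination h - Polynomial.aeval (tpow e) Q * hS

/-- A denominator of a series on a ray with a pole of order `m` is divisible by `φ_e^m`. -/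
theorem phiVec_pow_dvd_of_growth (he : e ≠ 0) (hF : SupportedOnRay α e F) {m : ℕ} (hm : m ≠ 0)
    {a : Fin m → ℕ} (ha : ∀ i, a i ≠ 0)
    (hpoly : IsPoly (((∏ i, (1 - tpow (a i • e)) : MvPolynomial (Fin r) ℤ) :
      MvPowerSeries (Fin r) ℤ) * F))
    (hpos : ∀ k, 0 ≤ PowerSeries.coeff k (raySeries α e F)) (A : ℕ)
    (hA : ∀ n : ℕ, ((n : ℤ) + 1) ^ m ≤
      ∑ k ∈ Finset.range (A * n + 1), PowerSeries.coeff k (raySeries α e F))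
    {B : MvPolynomial (Fin r) ℤ} (hB : IsPoly ((B : MvPowerSeries (Fin r) ℤ) * F)) :
    phiVec e ^ m ∣ B := by
  set q : Polynomial ℤ := ∏ i, (1 - Polynomial.X ^ a i) with hq
  have hq' : ∏ i, (1 - tpow (a i • e)) = Polynomial.aeval (tpow e) q := by
    rw [hq, map_prod]
    simp only [map_sub, map_one, map_pow, Polynomial.aeval_X, tpow_nsmul]
  rw [hq'] at hpoly
  obtain ⟨p, hp⟩ := hpoly
  obtain ⟨C, hC⟩ := hB
  obtain ⟨hray, hray'⟩ := raySeries_aeval_mul he hF q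
  obtain ⟨P, rfl⟩ := exists_eq_tpow_mul_aeval (hp ▸ hray)
  have hP : P.eval 1 ≠ 0 := by
    refine eval_one_ne_zero_of_growth hm ha hpos ?_ A hA
    rw [← hray', ← hp, mul_comm, MvPolynomial.coe_mul,
      (raySeries_aeval_mul he supportedOnRay_tpow P).2, raySeries_tpow he, mul_one]
  -- Two expressions for `B q(t^e) F`. The power of `φ_e` divides `q(t^e)` and is prime to `t^α
  -- P(t^e)`, so it divides `B`.
  have heq : B * (tpow α * Polynomial.aeval (tpow e) P) = Polynomial.aeval (tpow e) q * C := by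
    rw [← MvPolynomial.coe_inj, MvPolynomial.coe_mul, hp, MvPolynomial.coe_mul, hC]
    ring
  have hdvd : phiVec e ^ m ∣ Polynomial.aeval (tpow e) q := by
    rw [← hq']
    have := Finset.prod_dvd_prod_of_dvd (fun _ : Fin m => phiVec e) (fun i => 1 - tpow (a i • e))
      (s := Finset.univ) fun i _ => (phiVec_dvd_one_sub_tpow he).trans (one_sub_tpow_dvd (a i) e)
    simpa using this
  have h1 : phiVec e ^ m ∣ B * (tpow α * Polynomial.aeval (tpow e) P) :=
    heq ▸ hdvd.mul_right C
  refine IsRelPrime.dvd_of_dvd_mul_right ?_ h1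
  exact IsRelPrime.pow_left (IsRelPrime.mul_right (isRelPrime_tpow (constantCoeff_phiVec e) α)
    (isRelPrime_phiVec_aeval he hP))

end Ray

/-! ### Krull dimension, finite maps and annihilators. -/

section Dimension

/-- Contraction of primes along an integral map is strictly monotone (incomparability), and
contracted primes contain the kernel. -/
theorem ringKrullDim_le_quotient_ker_of_finite {A S : Type*} [CommRing A] [CommRing S] (g : A →+* S)
    (hg : g.Finite) : ringKrullDim S ≤ ringKrullDim (A ⧸ RingHom.ker g) := by
  rw [ringKrullDim_quotient]
  algebraize [g]
  have : Algebra.IsIntegral A S := Algebra.IsIntegral.of_finite A S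
  refine Order.krullDim_le_of_strictMono
    (fun q => ⟨PrimeSpectrum.comap g q, fun a ha => ?_⟩) fun p q hpq => ?_
  · have : g a = 0 := ha
    simp [this]
  · exact Ideal.IsIntegral.comap_lt_comap (R := A) (I := p.asIdeal) (J := q.asIdeal) hpq

/-- A nonzero element of the kernel would bring the dimension of the quotient of the polynomial
domain below `m`. -/
theorem injective_of_finite_of_le_ringKrullDim {K S : Type*} [Field K] [CommRing S] {m : ℕ}
    (g : MvPolynomial (Fin m) K →+* S) (hg : g.Finite) (hm : (m : WithBot ℕ∞) ≤ ringKrullDim S) :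
    Function.Injective g := by
  rw [injective_iff_map_eq_zero]
  intro p hp
  by_contra hp0
  have h1 := ringKrullDim_le_quotient_ker_of_finite g hg
  have h2 := ringKrullDim_succ_le_of_surjective (Ideal.Quotient.mk (RingHom.ker g))
    Ideal.Quotient.mk_surjective (mem_nonZeroDivisors_of_ne_zero hp0)
    (Ideal.Quotient.eq_zero_iff_mem.mpr hp)
  rw [MvPolynomial.ringKrullDim_of_isNoetherianRing, ringKrullDim_eq_zero_of_field] at h2
  have h3 : ((m + 1 : ℕ) : WithBot ℕ∞) ≤ m := by
    push_cast
    refine (add_le_add_left (hm.trans h1) 1).trans (h2.trans ?_)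
    simp
  have : m + 1 ≤ m := by exact_mod_cast h3
  omega

variable {K R M : Type*} [Field K] [CommRing R] [Algebra K R] [AddCommGroup M] [Module K M]
  [Module R M] [IsScalarTower K R M]

/-- The smallest prime of a long chain contains the intersection of the finitely many `Ann x`, hence
one of them; then so does the whole chain. -/
theorem exists_mem_le_ringKrullDim {T : Finset M} (hT : Submodule.span R (T : Set M) = ⊤)
    (I : Ideal R) {m : ℕ} (hm : (m : WithBot ℕ∞) ≤ ringKrullDim (R ⧸ (Module.annihilator R M ⊔ I))) :
    ∃ x ∈ T, (m : WithBot ℕ∞) ≤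
      ringKrullDim (R ⧸ (LinearMap.ker (LinearMap.toSpanSingleton R M x) ⊔ I)) := by
  rw [ringKrullDim_quotient] at hm
  obtain ⟨l, hl⟩ := Order.le_krullDim_iff.mp hm
  have hann : T.inf (fun x => LinearMap.ker (LinearMap.toSpanSingleton R M x)) ≤
      Module.annihilator R M := by
    intro a ha
    rw [Module.mem_annihilator]
    have : ∀ x ∈ T, a • x = 0 := fun x hx => Submodule.mem_finsetInf.mp ha x hx
    intro y
    have hy : y ∈ Submodule.span R (T : Set M) := hT ▸ trivial
    induction hy using Submodule.span_induction with
    | mem y hy => exact this y hy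
    | zero => exact smul_zero a
    | add y z _ _ hy hz => rw [smul_add, hy, hz, add_zero]
    | smul b y _ hy => rw [smul_comm, hy, smul_zero]
  have hhead : Module.annihilator R M ⊔ I ≤ l.head.1.asIdeal := l.head.2
  obtain ⟨x, hx, hxl⟩ := l.head.1.isPrime.inf_le'.mp (hann.trans (le_sup_left.trans hhead))
  refine ⟨x, hx, ?_⟩
  rw [ringKrullDim_quotient]
  refine Order.le_krullDim_iff.mpr ⟨LTSeries.mk l.length (fun i => ⟨(l i).1, ?_⟩) fun i j hij => ?_, hl⟩
  · have hle : l.head.1.asIdeal ≤ (l i).1.asIdeal := l.head_le i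
    exact (sup_le (hxl.trans hle) ((le_sup_right.trans hhead).trans hle) :
      _ ≤ (l i).1.asIdeal)
  · exact l.strictMono hij

end Dimension

/-! ### Divisibility of common denominators by `φ_e^{m_e}`. -/

section LowerBound

variable {K R M : Type*} [Field K] [CommRing R] [Algebra K R] [AddCommGroup M] [Module K M]
  [Module R M] [IsScalarTower K R M] {r : ℕ}
  {𝒜 : (Fin r → ℕ) → Submodule K R} [GradedAlgebra 𝒜]
  {ℳ : (Fin r → ℤ) → Submodule K M} [DirectSum.Decomposition ℳ]

/-- By noetherianity `Rx ≅ R/Ann x` is finite over `K[f, g]`, and the `g j` vanish modulo `I`, so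
the quotient is finite over the polynomial ring in the `f i` alone. -/
theorem finite_aeval_quotient {ι κ : Type*} [Finite ι] [Finite κ] {f : ι → R} {g : κ → R}
    [Module.Finite (Algebra.adjoin K (Set.range (Sum.elim f g))) M] {I : Ideal R}
    (hg : ∀ j, g j ∈ I) (x : M) :
    (MvPolynomial.aeval (R := K) fun i => Ideal.Quotient.mk
      (LinearMap.ker (LinearMap.toSpanSingleton R M x) ⊔ I) (f i)).toRingHom.Finite := by
  set 𝔟 := LinearMap.ker (LinearMap.toSpanSingleton R M x) ⊔ I with h𝔟
  set φ := MvPolynomial.aeval (R := K) fun i => Ideal.Quotient.mk 𝔟 (f i) with hφ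
  set T := Algebra.adjoin K (Set.range (Sum.elim f g))
  have : IsNoetherian T M := isNoetherian_adjoin _
  obtain ⟨Q, hQ⟩ := IsNoetherian.noetherian ((Submodule.span R {x}).restrictScalars T)
  have hQx : ∀ y ∈ Q, ∃ b : R, b • x = y := fun y hy =>
    Submodule.mem_span_singleton.mp
      (hQ ▸ Submodule.subset_span hy : y ∈ (Submodule.span R {x}).restrictScalars T)
  choose! b hb using hQx
  let := φ.toRingHom.toAlgebra
  classical
  refine ⟨⟨Q.image fun y => Ideal.Quotient.mk 𝔟 (b y), ?_⟩⟩
  have hrange : ∀ τ ∈ T, ∃ p, φ p = Ideal.Quotient.mk 𝔟 τ := by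
    intro τ hτ
    have hle : T ≤ φ.range.comap (Ideal.Quotient.mkₐ K 𝔟) := by
      refine Algebra.adjoin_le ?_
      rintro _ ⟨i | j, rfl⟩
      · exact ⟨MvPolynomial.X i, by simp [hφ]⟩
      · refine ⟨0, ?_⟩
        rw [map_zero]
        exact (Ideal.Quotient.eq_zero_iff_mem.mpr (Submodule.mem_sup_right (hg j))).symm
    exact hle hτ
  refine top_le_iff.mp fun y _ => ?_
  obtain ⟨a, rfl⟩ := Ideal.Quotient.mk_surjective y
  suffices h : ∀ z ∈ Submodule.span T (Q : Set M), ∃ a : R, a • x = z ∧ Ideal.Quotient.mk 𝔟 a ∈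
      Submodule.span (MvPolynomial ι K)
        ((Q.image fun y => Ideal.Quotient.mk 𝔟 (b y) : Finset (R ⧸ 𝔟)) : Set (R ⧸ 𝔟)) by
    have hax : a • x ∈ Submodule.span T (Q : Set M) := by
      rw [hQ]
      exact Submodule.mem_span_singleton.mpr ⟨a, rfl⟩
    obtain ⟨a', ha', hmem⟩ := h _ hax
    have : Ideal.Quotient.mk 𝔟 a = Ideal.Quotient.mk 𝔟 a' := by
      rw [Ideal.Quotient.eq]
      refine Submodule.mem_sup_left ?_
      rw [LinearMap.mem_ker, LinearMap.toSpanSingleton_apply, sub_smul, ha', sub_self]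
    rwa [this]
  intro z hz
  induction hz using Submodule.span_induction with
  | mem z hz =>
    exact ⟨b z, hb z hz, Submodule.subset_span (Finset.mem_coe.mpr (Finset.mem_image_of_mem _ hz))⟩
  | zero => exact ⟨0, zero_smul R x, by simp⟩
  | add y z _ _ hy hz =>
    obtain ⟨a, rfl, ha⟩ := hy
    obtain ⟨a', rfl, ha'⟩ := hz
    exact ⟨a + a', add_smul _ _ _, by rw [map_add]; exact add_mem ha ha'⟩
  | smul τ y _ hy =>
    obtain ⟨a, rfl, ha⟩ := hy
    obtain ⟨p, hp⟩ := hrange τ τ.2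
    refine ⟨τ * a, mul_smul _ _ _, ?_⟩
    rw [map_mul, ← hp]
    exact Submodule.smul_mem _ p ha

theorem isHomogeneous_idealI_smul_span (hsmul : GradedAction 𝒜 ℳ) (e : Fin r → ℕ) {x : M}
    {d : Fin r → ℤ} (hx : x ∈ ℳ d) : (idealI 𝒜 e • Submodule.span R {x}).IsHomogeneous ℳ := by
  rw [idealI, Submodule.span_smul_span]
  refine isHomogeneous_span hsmul ?_
  intro y hy
  obtain ⟨a, ⟨δ, -, ha⟩, z, hz, rfl⟩ := Set.mem_smul.mp hy
  rw [Set.mem_singleton_iff.mp hz]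
  exact ⟨_, hsmul δ d a ha x hx⟩

/-- The degrees in which `Rx / I^{[e]}x` does not vanish lie in `deg x + ℕ e`. -/
theorem exists_eq_add_nsmul (hsmul : GradedAction 𝒜 ℳ) {e : Fin r → ℕ} {x : M}
    {d : Fin r → ℤ} (hx : x ∈ ℳ d) {d' : Fin r → ℤ}
    (h : hilbertSeries ℳ (Submodule.span R {x}) d' ≠
      hilbertSeries ℳ (idealI 𝒜 e • Submodule.span R {x}) d') :
    ∃ k : ℕ, ∀ i, d' i = d i + k * e i := by
  by_contra hne
  apply h
  have key : ∀ b : R, proj ℳ d' (b • x) ∈ idealI 𝒜 e • Submodule.span R {x} := by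
    intro b
    induction b using DirectSum.Decomposition.inductionOn 𝒜 with
    | zero => simp
    | @homogeneous δ b =>
      have hb := hsmul δ d b b.2 x hx
      by_cases hd : (fun i => (δ i : ℤ) + d i) = d'
      · subst hd
        rw [proj_of_mem ℳ hb]
        refine Submodule.smul_mem_smul (mem_idealI 𝒜 ?_ b.2) (Submodule.mem_span_singleton_self x)
        rintro ⟨k, rfl⟩
        exact hne ⟨k, fun i => by simp [add_comm]⟩
      · rw [proj_of_mem_of_ne ℳ hb hd]
        exact zero_mem _
    | add a b ha hb => rw [add_smul, map_add]; exact add_mem ha hb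
  have heq : (Submodule.span R {x}).restrictScalars K ⊓ ℳ d' =
      (idealI 𝒜 e • Submodule.span R {x}).restrictScalars K ⊓ ℳ d' := by
    refine le_antisymm (fun y hy => ⟨?_, hy.2⟩) (inf_le_inf_right _
      (show idealI 𝒜 e • Submodule.span R {x} ≤ Submodule.span R {x} from Submodule.smul_le_right))
    obtain ⟨b, hb⟩ := Submodule.mem_span_singleton.mp (show y ∈ Submodule.span R {x} from hy.1)
    rw [← proj_of_mem ℳ hy.2, ← hb]
    exact key b
  rw [hilbertSeries, hilbertSeries, heq]

/-- The number of monomials in `f₁, …, f_m` of given degree with bounded exponents is at most the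
dimension of the corresponding component of `Rx / I^{[e]}x`. -/
theorem card_filter_le_hilbertSeries_sub [∀ d, FiniteDimensional K (ℳ d)]
    (hsmul : GradedAction 𝒜 ℳ) {e : Fin r → ℕ} {x : M} {d : Fin r → ℤ} (hx : x ∈ ℳ d)
    {m : ℕ} {f : Fin m → R} {k : Fin m → ℕ} (hf : ∀ i, f i ∈ 𝒜 (k i • e))
    (hinj : Function.Injective (MvPolynomial.aeval (R := K) fun i => Ideal.Quotient.mk
      (LinearMap.ker (LinearMap.toSpanSingleton R M x) ⊔ idealI 𝒜 e) (f i)))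
    (n κ : ℕ) :
    ((Finset.univ.filter fun j : Fin m → Fin (n + 1) => ∑ i, (j i : ℕ) * k i = κ).card : ℤ) ≤
      hilbertSeries ℳ (Submodule.span R {x}) (fun i => d i + κ * e i) -
        hilbertSeries ℳ (idealI 𝒜 e • Submodule.span R {x}) (fun i => d i + κ * e i) := by
  classical
  set N := Submodule.span R {x}
  set N' := idealI 𝒜 e • N
  set d' : Fin r → ℤ := fun i => d i + κ * e i
  rw [hilbertSeries_eq_add (Submodule.smul_le_right : N' ≤ N) d', add_sub_cancel_left]
  set W := (N.restrictScalars K ⊓ ℳ d').map (N'.mkQ.restrictScalars K)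
  have hfin : FiniteDimensional K ↥(N.restrictScalars K ⊓ ℳ d') :=
    Submodule.finiteDimensional_of_le inf_le_right
  -- The map `p ↦ p(f) x` modulo `I^{[e]} x` is injective: `p(f) x ∈ I^{[e]} x` means `p(f) ∈ Ann x
  -- + I^{[e]}`.
  let ψ : MvPolynomial (Fin m) K →ₗ[K] M ⧸ N' := ((N'.mkQ ∘ₗ
    LinearMap.toSpanSingleton R M x).restrictScalars K) ∘ₗ (MvPolynomial.aeval f).toLinearMap
  have hψ : LinearMap.ker ψ = ⊥ := by
    refine LinearMap.ker_eq_bot'.mpr fun p hp => hinj ?_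
    have hp' : MvPolynomial.aeval f p • x ∈ N' := (Submodule.Quotient.mk_eq_zero N').mp hp
    obtain ⟨a, ha, hax⟩ := Submodule.mem_smul_span_singleton.mp hp'
    have hmem : MvPolynomial.aeval f p ∈
        LinearMap.ker (LinearMap.toSpanSingleton R M x) ⊔ idealI 𝒜 e := by
      refine Submodule.mem_sup.mpr ⟨MvPolynomial.aeval f p - a, ?_, a, ha, sub_add_cancel _ _⟩
      rw [LinearMap.mem_ker, LinearMap.toSpanSingleton_apply, sub_smul, hax, sub_self]
    have hcomp : (MvPolynomial.aeval (R := K) fun i => Ideal.Quotient.mk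
      (LinearMap.ker (LinearMap.toSpanSingleton R M x) ⊔ idealI 𝒜 e) (f i)) =
      (Ideal.Quotient.mkₐ K _).comp (MvPolynomial.aeval f) := by
      ext i
      simp
    rw [map_zero, hcomp]
    exact Ideal.Quotient.eq_zero_iff_mem.mpr hmem
  let J := {j : Fin m → Fin (n + 1) // ∑ i, (j i : ℕ) * k i = κ}
  let μ : J → Fin m →₀ ℕ := fun j => Finsupp.equivFunOnFinite.symm fun i => (j.1 i : ℕ)
  have hμ : Function.Injective μ := fun j j' h => by
    apply Subtype.ext
    ext i
    exact DFunLike.congr_fun h i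
  have hlin : LinearIndependent K (fun j : J => ψ (MvPolynomial.monomial (μ j) 1)) := by
    have := ((MvPolynomial.basisMonomials (Fin m) K).linearIndependent.comp μ hμ).map' ψ hψ
    simpa [Function.comp_def] using this
  have hmem : Submodule.span K (Set.range fun j : J => ψ (MvPolynomial.monomial (μ j) 1)) ≤ W := by
    rw [Submodule.span_le]
    rintro _ ⟨j, rfl⟩
    refine ⟨MvPolynomial.aeval f (MvPolynomial.monomial (μ j) (1 : K)) • x, ⟨?_, ?_⟩, rfl⟩
    · exact Submodule.smul_mem _ _ (Submodule.mem_span_singleton_self x)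
    · have hdeg : MvPolynomial.aeval f (MvPolynomial.monomial (μ j) (1 : K)) ∈ 𝒜 (κ • e) := by
        rw [MvPolynomial.aeval_monomial, map_one, one_mul, Finsupp.prod_fintype _ _ (by simp)]
        have := SetLike.prod_mem_graded (A := 𝒜) (F := Finset.univ)
          (fun i => (j.1 i : ℕ) • (k i • e)) (fun i => f i ^ (j.1 i : ℕ))
          fun i _ => SetLike.pow_mem_graded _ (hf i)
        simp only [← mul_smul, ← Finset.sum_smul] at this
        have hκ : (∑ i, (j.1 i : ℕ) * k i) • e = κ • e := congrArg (· • e) j.2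
        exact hκ ▸ this
      have := hsmul _ _ _ hdeg x hx
      have hd' : (fun i => (((κ • e) i : ℕ) : ℤ) + d i) = d' := by
        ext i
        simp [d', add_comm]
      exact hd' ▸ this
  have hcard := finrank_span_eq_card hlin
  rw [← Fintype.card_subtype, ← hcard]
  exact_mod_cast Submodule.finrank_mono hmem

/-- Any common denominator is divisible by `φ_e^{m_e}`. -/
theorem phiVec_pow_mult_dvd [Algebra.FiniteType K R] [FiniteDimensional K (𝒜 0)]
    [Module.Finite R M] [∀ d, FiniteDimensional K (ℳ d)] (hsmul : GradedAction 𝒜 ℳ)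
    {c : Fin r → ℤ} (hc : ∀ d, ∀ x ∈ ℳ d, x ≠ 0 → c ≤ d) {e : Fin r → ℕ} (he : e ≠ 0)
    {B : MvPolynomial (Fin r) ℤ} (hB : ∀ N : Submodule R M, N.IsHomogeneous ℳ →
      IsPoly ((B : MvPowerSeries (Fin r) ℤ) * hilbertPowerSeries c ℳ N)) :
    phiVec e ^ mult 𝒜 M e ∣ B := by
  classical
  by_cases hm : mult 𝒜 M e = 0
  · rw [hm, pow_zero]
    exact one_dvd B
  obtain ⟨G, f, k, η, hk, hf, hη, hG, hfin⟩ := exists_system 𝒜 (M := M) e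
  have hadj : Module.Finite (Algebra.adjoin K (Set.range (Sum.elim f ((↑) : G → R)))) M := by
    refine finite_adjoin hsmul (δ := Sum.elim (fun i => k i • e) η) ?_ ?_
    · rintro (i | g)
      · exact hf i
      · exact hG g
    · rintro (i | g)
      · exact smul_ne_zero (hk i) he
      · exact fun h => hη g ⟨0, by simpa using h⟩
  obtain ⟨T, hT, hspan⟩ := exists_homogeneous_generators R ℳ
  obtain ⟨x, hxT, hxdim⟩ := exists_mem_le_ringKrullDim hspan (idealI 𝒜 e) (m := mult 𝒜 M e)
    ((suppDim_eq_mult 𝒜 hm).symm.trans (suppDim_eq 𝒜 e)).le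
  obtain ⟨d, hx⟩ := hT x hxT
  have hinj := injective_of_finite_of_le_ringKrullDim _
    (finite_aeval_quotient (K := K) (f := f) (g := ((↑) : G → R))
      (fun g => mem_idealI 𝒜 (hη g) (hG g)) x) hxdim
  have hx0 : x ≠ 0 := by
    rintro rfl
    have : Subsingleton (R ⧸ (LinearMap.ker (LinearMap.toSpanSingleton R M 0) ⊔ idealI 𝒜 e)) := by
      rw [Ideal.Quotient.subsingleton_iff, LinearMap.toSpanSingleton_zero, LinearMap.ker_zero,
        top_sup_eq]
    rw [ringKrullDim_eq_bot_of_subsingleton] at hxdim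
    exact absurd (le_bot_iff.mp hxdim) (by simp)
  set N := Submodule.span R {x}
  set N' := idealI 𝒜 e • N
  have hN : N.IsHomogeneous ℳ := isHomogeneous_span hsmul (by rintro _ rfl; exact ⟨d, hx⟩)
  have hN' : N'.IsHomogeneous ℳ := isHomogeneous_idealI_smul_span hsmul e hx
  set F := hilbertPowerSeries c ℳ N - hilbertPowerSeries c ℳ N'
  set α : Fin r → ℕ := fun i => (d i - c i).toNat
  have hα : ∀ i, (α i : ℤ) + c i = d i := fun i => by
    have : c i ≤ d i := hc d x hx hx0 i
    simp only [α]
    omega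
  have hcoeff : ∀ κ, PowerSeries.coeff κ (raySeries α e F) =
      hilbertSeries ℳ N (fun i => d i + κ * e i) - hilbertSeries ℳ N' (fun i => d i + κ * e i) := by
    intro κ
    rw [raySeries, PowerSeries.coeff_mk, map_sub, hilbertPowerSeries, hilbertPowerSeries,
      coeff_shiftSeries, coeff_shiftSeries]
    have : (fun i => ((Finsupp.equivFunOnFinite.symm (α + κ • e) i : ℕ) : ℤ) + c i) =
        fun i => d i + κ * e i := by
      ext i
      rw [← hα i]
      simp only [Finsupp.equivFunOnFinite_symm_apply_apply, Pi.add_apply, Pi.smul_apply,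
        smul_eq_mul]
      push_cast
      ring
    rw [this]
  have hray : SupportedOnRay α e F := by
    intro a ha
    have hne : hilbertSeries ℳ N (fun i => (a i : ℤ) + c i) ≠
        hilbertSeries ℳ N' (fun i => (a i : ℤ) + c i) := fun h => ha (sub_eq_zero.mpr h)
    obtain ⟨κ, hκ⟩ := exists_eq_add_nsmul hsmul hx hne
    refine ⟨κ, ?_⟩
    ext i
    have h1 := hκ i
    have h2 := hα i
    have h3 : (a i : ℤ) = α i + κ * e i := by linarith
    simpa using (by exact_mod_cast h3 : a i = α i + κ * e i)
  have hcount := card_filter_le_hilbertSeries_sub hsmul hx hf hinj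
  -- The constant is `∑ k i` because the `(n + 1)^m` monomials with exponents at most `n` have
  -- degrees `κ • e` with `κ ≤ (∑ k i) n`.
  refine phiVec_pow_dvd_of_growth he hray hm hk ?_ (fun κ => ?_) (∑ i, k i) (fun n => ?_) ?_
  -- The elements of `G` lie in `I^{[e]}` and kill `N/N'`, so only the factors of the `f i` remain
  -- in the denominator.
  · have := isPoly_prod_mul_hilbertPowerSeries_sub hsmul hc
      (f := Sum.elim f ((↑) : G → R)) (δ := Sum.elim (fun i => k i • e) η)
      (by
        rintro (i | g)
        · exact hf i
        · exact hG g)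
      (Finset.univ.image Sum.inl) hN hN' Submodule.smul_le_right (by
        rintro (i | g) hi y hy
        · exact absurd (Finset.mem_image_of_mem _ (Finset.mem_univ i)) hi
        · exact Submodule.smul_mem_smul (mem_idealI 𝒜 (hη g) (hG g)) hy)
    rwa [Finset.prod_image fun _ _ _ _ h => Sum.inl_injective h] at this
  · rw [hcoeff]
    exact (Nat.cast_nonneg _).trans (hcount 0 κ)
  · calc ((n : ℤ) + 1) ^ mult 𝒜 M e
        = ((Finset.univ : Finset (Fin (mult 𝒜 M e) → Fin (n + 1))).card : ℤ) := by
          simp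
      _ = ∑ κ ∈ Finset.range ((∑ i, k i) * n + 1), ((Finset.univ.filter
          fun j : Fin (mult 𝒜 M e) → Fin (n + 1) => ∑ i, (j i : ℕ) * k i = κ).card : ℤ) := by
          rw [← Nat.cast_sum]
          congr 1
          refine Finset.card_eq_sum_card_fiberwise fun j _ => ?_
          rw [Finset.mem_coe, Finset.mem_range, Nat.lt_succ_iff, Finset.sum_mul]
          refine Finset.sum_le_sum fun i _ => ?_
          rw [mul_comm]
          exact Nat.mul_le_mul_left _ (Nat.lt_succ_iff.mp (j i).2)
      _ ≤ _ := Finset.sum_le_sum fun κ _ => (hcount n κ).trans (hcoeff κ).ge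
  · have := (hB N hN).sub (hB N' hN')
    rwa [← mul_sub] at this

end LowerBound

/-! ### Intersecting denominators down to the exponents `m_e`. -/

section UniversalDenominator

variable {K R M : Type*} [Field K] [CommRing R] [Algebra K R] [AddCommGroup M] [Module K M]
  [Module R M] [IsScalarTower K R M] {r : ℕ}
  {𝒜 : (Fin r → ℕ) → Submodule K R} [GradedAlgebra 𝒜]
  {ℳ : (Fin r → ℤ) → Submodule K M} [DirectSum.Decomposition ℳ]

/-- `B H(N,t)` is a Laurent polynomial for every graded submodule `N`. -/
def ClearsDenominators (R : Type*) [CommRing R] [Algebra K R] [Module R M] [IsScalarTower K R M]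
    (c : Fin r → ℤ) (ℳ : (Fin r → ℤ) → Submodule K M) [DirectSum.Decomposition ℳ]
    (B : MvPolynomial (Fin r) ℤ) : Prop :=
  ∀ N : Submodule R M, N.IsHomogeneous ℳ →
    IsPoly ((B : MvPowerSeries (Fin r) ℤ) * hilbertPowerSeries c ℳ N)

theorem isCommonDenominator_iff {c : Fin r → ℤ} (hc : ∀ d, ∀ x ∈ ℳ d, x ≠ 0 → c ≤ d)
    (B : MvPolynomial (Fin r) ℤ) : IsCommonDenominator R ℳ B ↔
      MvPolynomial.constantCoeff B = 1 ∧ ClearsDenominators R c ℳ B := by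
  refine and_congr_right fun _ => forall₂_congr fun N _ => ?_
  exact isLaurentPolynomial_polyMul_iff (le_of_hilbertSeries_ne_zero hc N) B

theorem ClearsDenominators.of_dvd {c : Fin r → ℤ} {B B' : MvPolynomial (Fin r) ℤ}
    (hB : ClearsDenominators R c ℳ B) (h : B ∣ B') : ClearsDenominators R c ℳ B' := by
  obtain ⟨A, rfl⟩ := h
  intro N hN
  rw [MvPolynomial.coe_mul, mul_comm (B : MvPowerSeries (Fin r) ℤ), mul_assoc]
  exact (isPoly_coe A).mul (hB N hN)

theorem ClearsDenominators.phiProd_inf {c : Fin r → ℤ} {n n' : (Fin r → ℕ) →₀ ℕ}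
    (h : ClearsDenominators R c ℳ (phiProd n)) (h' : ClearsDenominators R c ℳ (phiProd n')) :
    ClearsDenominators R c ℳ (phiProd (n ⊓ n')) := by
  obtain ⟨a, b, ha, hab, hn, hn'⟩ := exists_isRelPrime_phiProd n n'
  intro N hN
  exact IsPoly.of_isRelPrime ha hab (hn ▸ h N hN) (hn' ▸ h' N hN)

/-- A parameter of degree `0` makes `p = 0`; for this reason `ClearsDenominators` does not ask for
constant coefficient `1`. -/
theorem clearsDenominators_of_mem_parameterProducts [∀ d, FiniteDimensional K (ℳ d)]
    (hsmul : GradedAction 𝒜 ℳ) {c : Fin r → ℤ} (hc : ∀ d, ∀ x ∈ ℳ d, x ≠ 0 → c ≤ d)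
    {p : MvPolynomial (Fin r) ℤ} (hp : p ∈ parameterProducts 𝒜 M) :
    ClearsDenominators R c ℳ p := by
  obtain ⟨s, f, δ, hf, hfin, rfl⟩ := hp
  intro N hN
  have hbot : hilbertPowerSeries c ℳ (⊥ : Submodule R M) = 0 := by
    ext a
    rw [hilbertPowerSeries, coeff_shiftSeries, hilbertSeries, Submodule.restrictScalars_bot,
      bot_inf_eq, finrank_bot]
    rfl
  have := isPoly_prod_mul_hilbertPowerSeries_sub hsmul hc hf Finset.univ hN (N' := ⊥)
    (fun d x hx => by
      rw [(Submodule.mem_bot R).mp hx, DirectSum.decompose_zero]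
      exact zero_mem _) bot_le fun i hi => absurd (Finset.mem_univ i) hi
  rwa [hbot, sub_zero] at this

theorem prod_mem_parameterProducts {ι : Type*} [Fintype ι] {f : ι → R} {δ : ι → Fin r → ℕ}
    (hf : ∀ i, f i ∈ 𝒜 (δ i)) (hfin : Module.Finite (Algebra.adjoin K (Set.range f)) M) :
    ∏ i, (1 - tpow (δ i)) ∈ parameterProducts 𝒜 M := by
  let E := (Fintype.equivFin ι).symm
  refine ⟨Fintype.card ι, f ∘ E, δ ∘ E, fun i => hf (E i), ?_, ?_⟩
  · rwa [E.surjective.range_comp]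
  · exact (E.prod_comp fun i => 1 - tpow (δ i)).symm

theorem phiProd_mem_parameterProducts [Module.Finite R M] (hsmul : GradedAction 𝒜 ℳ)
    {ι : Type*} [Fintype ι] {f : ι → R} {δ : ι → Fin r → ℕ}
    (hf : ∀ i, f i ∈ 𝒜 (δ i)) (hδ : ∀ i, δ i ≠ 0)
    [Module.Finite K (R ⧸ (Module.annihilator R M ⊔ Ideal.span (Set.range f)))] :
    phiProd (∑ i, divisorIndicator (δ i)) ∈ parameterProducts 𝒜 M := by
  rw [phiProd_sum, Finset.prod_congr rfl fun i _ => phiProd_divisorIndicator (hδ i)]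
  exact prod_mem_parameterProducts hf (finite_adjoin hsmul hf hδ)

/-- In the system adapted to `e` only the degrees `k i • e` are divisible by `e`, and each
contributes `φ_e` at most once. -/
theorem exists_phiProd_le_mult [Algebra.FiniteType K R] [FiniteDimensional K (𝒜 0)]
    [Module.Finite R M] (hsmul : GradedAction 𝒜 ℳ) {e : Fin r → ℕ} (he : e ≠ 0) :
    ∃ n : (Fin r → ℕ) →₀ ℕ, phiProd n ∈ parameterProducts 𝒜 M ∧ n e ≤ mult 𝒜 M e := by
  obtain ⟨G, f, k, η, hk, hf, hη, hG, hfin⟩ := exists_system 𝒜 (M := M) e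
  have hmem := phiProd_mem_parameterProducts hsmul
    (f := Sum.elim f ((↑) : G → R)) (δ := Sum.elim (fun i => k i • e) η)
    (by
      rintro (i | g)
      · exact hf i
      · exact hG g)
    (by
      rintro (i | g)
      · exact smul_ne_zero (hk i) he
      · exact fun h => hη g ⟨0, by simpa using h⟩)
  refine ⟨_, hmem, ?_⟩
  rw [Fintype.sum_sum_type, Finsupp.add_apply, Finsupp.finsetSum_apply, Finsupp.finsetSum_apply]
  simp only [Sum.elim_inl, Sum.elim_inr]
  rw [Finset.sum_eq_zero fun g _ => divisorIndicator_eq_zero (hη g), add_zero]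
  refine (Finset.sum_le_card_nsmul _ _ 1 fun i _ =>
    divisorIndicator_le_one (smul_ne_zero (hk i) he) e).trans ?_
  simp

/-- The property of `n` that `φ^n` clears denominators and is divisible by all common divisors of
the parameter products is closed under infima; hence it holds for some `n ≤ m`. -/
theorem exists_phiProd_clearsDenominators [Algebra.FiniteType K R] [FiniteDimensional K (𝒜 0)]
    [Module.Finite R M] [∀ d, FiniteDimensional K (ℳ d)] (hsmul : GradedAction 𝒜 ℳ)
    {c : Fin r → ℤ} (hc : ∀ d, ∀ x ∈ ℳ d, x ≠ 0 → c ≤ d) :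
    ∃ n : (Fin r → ℕ) →₀ ℕ, (∀ e, n e ≤ mult 𝒜 M e) ∧ ClearsDenominators R c ℳ (phiProd n) ∧
      ∀ C, (∀ p ∈ parameterProducts 𝒜 M, C ∣ p) → C ∣ phiProd n := by
  classical
  obtain ⟨G, η, hη, hG, hGfin⟩ := exists_irrelevant_system 𝒜
  have := hGfin (Module.annihilator R M ⊔ Ideal.span (Set.range ((↑) : G → R))) le_sup_right
  set n₀ := ∑ g, divisorIndicator (η g)
  have hn₀ : phiProd n₀ ∈ parameterProducts 𝒜 M :=
    phiProd_mem_parameterProducts hsmul (f := ((↑) : G → R)) hG hη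
  have hzero : n₀ 0 = 0 := by
    rw [Finsupp.finsetSum_apply]
    exact Finset.sum_eq_zero fun g _ =>
      divisorIndicator_eq_zero fun h => hη g (vecDvd_zero_iff.mp h)
  -- Start from `n₀` and cut the exponent down at one vector of `s` after another. Since `n ≤ n₀`,
  -- taking `s` to be the support of `n₀` suffices.
  have key : ∀ s : Finset (Fin r → ℕ), 0 ∉ s → ∃ n ≤ n₀, (∀ e ∈ s, n e ≤ mult 𝒜 M e) ∧
      ClearsDenominators R c ℳ (phiProd n) ∧
      ∀ C, (∀ p ∈ parameterProducts 𝒜 M, C ∣ p) → C ∣ phiProd n := by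
    intro s
    induction s using Finset.induction_on with
    | empty =>
      exact fun _ => ⟨n₀, le_rfl, by simp,
        clearsDenominators_of_mem_parameterProducts hsmul hc hn₀, fun C hC => hC _ hn₀⟩
    | insert e s _ ih =>
      intro hs
      rw [Finset.mem_insert, not_or] at hs
      obtain ⟨n, hn, hns, hclear, hdvd⟩ := ih hs.2
      obtain ⟨n', hn', hn'e⟩ := exists_phiProd_le_mult (M := M) hsmul (Ne.symm hs.1)
      refine ⟨n ⊓ n', inf_le_left.trans hn, fun d hd => ?_, hclear.phiProd_inf
        (clearsDenominators_of_mem_parameterProducts hsmul hc hn'),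
        fun C hC => dvd_phiProd_inf (hdvd C hC) (hC _ hn')⟩
      rw [Finsupp.inf_apply]
      rcases Finset.mem_insert.mp hd with rfl | hd
      · exact inf_le_right.trans hn'e
      · exact inf_le_left.trans (hns d hd)
  obtain ⟨n, hn, hns, hclear, hdvd⟩ := key n₀.support (by simp [hzero])
  refine ⟨n, fun e => ?_, hclear, hdvd⟩
  by_cases he : e ∈ n₀.support
  · exact hns e he
  · have : n e ≤ 0 := (hn e).trans (Finsupp.notMem_support_iff.mp he).le
    omega

/-- Units of `ℤ[t]` are constants, so the normalization at `0` makes associated polynomials equal.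
-/
theorem eq_of_dvd_of_dvd {p q : MvPolynomial (Fin r) ℤ} (hp : MvPolynomial.constantCoeff p = 1)
    (hq : MvPolynomial.constantCoeff q = 1) (hpq : p ∣ q) (hqp : q ∣ p) : p = q := by
  obtain ⟨u, rfl⟩ := associated_of_dvd_dvd hpq hqp
  obtain ⟨a, -, ha⟩ := MvPolynomial.isUnit_iff_eq_C_of_isReduced.mp u.isUnit
  rw [ha] at hq ⊢
  have : a = 1 := by simpa [hp] using hq
  simp [this]

theorem phiProd_dvd_of_forall {n : (Fin r → ℕ) →₀ ℕ} {B : MvPolynomial (Fin r) ℤ}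
    (h : ∀ d ≠ 0, phiVec d ^ n d ∣ B) : phiProd n ∣ B := by
  refine Finset.prod_dvd_of_isRelPrime (fun d _ e _ hde => (isRelPrime_phiVec hde).pow)
    fun d _ => ?_
  by_cases hd : d = 0
  · show phiVec d ^ n d ∣ B
    rw [hd, phiVec_zero, one_pow]
    exact one_dvd B
  · exact h d hd

end UniversalDenominator

end UnivDenom

/-- Let `R` be an `ℕ^r`-graded `K`-algebra of finite type with `R_0` finite-dimensional and `M` a
finitely generated `ℤ^r`-graded `R`-module. The universal denominator of `M` exists, it equals
`∏_d φ_d(t)^{m_d}` (a finite product), and it is the greatest common divisor of all products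
`(1 - t^{d₁}) ⋯ (1 - t^{d_s})` attached to homogeneous `f₁, …, f_s` such that `M` is finite over
`K[f₁, …, f_s]`. -/
theorem mainTheorem1 {K R M : Type*} [Field K] [CommRing R] [Algebra K R]
    [AddCommGroup M] [Module K M] [Module R M] [IsScalarTower K R M] {r : ℕ}
    (𝒜 : (Fin r → ℕ) → Submodule K R) [GradedAlgebra 𝒜]
    [Algebra.FiniteType K R] [FiniteDimensional K (𝒜 0)]
    (ℳ : (Fin r → ℤ) → Submodule K M) [DirectSum.Decomposition ℳ]
    (hsmul : ∀ (e : Fin r → ℕ) (d : Fin r → ℤ), ∀ a ∈ 𝒜 e, ∀ x ∈ ℳ d,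
      a • x ∈ ℳ (fun i => (e i : ℤ) + d i))
    [Module.Finite R M] :
    UnivDenom.IsUniversalDenominator R ℳ (UnivDenom.udenom R ℳ) ∧
    ((∀ d, UnivDenom.suppDim 𝒜 M d ≠ ⊤) ∧
      {d | UnivDenom.mult 𝒜 M d ≠ 0}.Finite ∧
      UnivDenom.udenom R ℳ = ∏ᶠ d, UnivDenom.phiVec d ^ UnivDenom.mult 𝒜 M d) ∧
    ∀ C : MvPolynomial (Fin r) ℤ,
      C ∣ UnivDenom.udenom R ℳ ↔ ∀ p ∈ UnivDenom.parameterProducts 𝒜 M, C ∣ p := by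
  have hact : UnivDenom.GradedAction 𝒜 ℳ := hsmul
  have hmult : {d | UnivDenom.mult 𝒜 M d ≠ 0}.Finite := UnivDenom.finite_setOf_mult_ne_zero 𝒜
  obtain ⟨G, η, hη, hG, hGfin⟩ := UnivDenom.exists_irrelevant_system 𝒜
  have := hGfin (Module.annihilator R M ⊔ Ideal.span (Set.range ((↑) : G → R))) le_sup_right
  have hfin : ∀ d, FiniteDimensional K (ℳ d) := UnivDenom.finite_component hact hG hη
  obtain ⟨c, hc⟩ := UnivDenom.exists_lower_bound hact
  obtain ⟨n, hn, hclear, hdvd⟩ := UnivDenom.exists_phiProd_clearsDenominators (M := M) hact hc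
  let μ : (Fin r → ℕ) →₀ ℕ := Finsupp.ofSupportFinite (UnivDenom.mult 𝒜 M) hmult
  have hnμ : UnivDenom.phiProd n ∣ UnivDenom.phiProd μ := UnivDenom.phiProd_dvd_phiProd hn
  have hμ : UnivDenom.IsUniversalDenominator R ℳ (UnivDenom.phiProd μ) := by
    refine ⟨(UnivDenom.isCommonDenominator_iff hc _).mpr
      ⟨UnivDenom.constantCoeff_phiProd μ, hclear.of_dvd hnμ⟩, fun B hB => ?_⟩
    exact UnivDenom.phiProd_dvd_of_forall fun d hd => UnivDenom.phiVec_pow_mult_dvd hact hc hd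
      ((UnivDenom.isCommonDenominator_iff hc B).mp hB).2
  have hex : ∃ B, UnivDenom.IsUniversalDenominator R ℳ B := ⟨_, hμ⟩
  have hU : UnivDenom.IsUniversalDenominator R ℳ (UnivDenom.udenom R ℳ) := by
    rw [UnivDenom.udenom, dif_pos hex]
    exact hex.choose_spec
  have heq : UnivDenom.udenom R ℳ = UnivDenom.phiProd μ :=
    UnivDenom.eq_of_dvd_of_dvd hU.1.1 hμ.1.1 (hU.2 _ hμ.1) (hμ.2 _ hU.1)
  refine ⟨hU, ⟨UnivDenom.suppDim_ne_top 𝒜, hmult, ?_⟩, fun C => ⟨fun hC p hp => ?_, fun hC => ?_⟩⟩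
  · rw [heq, finprod_eq_prod_of_mulSupport_subset (s := μ.support)]
    · rfl
    · intro d hd
      rw [Finset.mem_coe, Finsupp.mem_support_iff]
      intro h0
      have h0' : UnivDenom.mult 𝒜 M d = 0 := h0
      exact hd (by simp [h0'])
  · rw [heq] at hC
    -- The lower bound needs only that `p` clears denominators, so it applies to parameter products,
    -- including `0`.
    refine hC.trans (UnivDenom.phiProd_dvd_of_forall fun d hd =>
      UnivDenom.phiVec_pow_mult_dvd hact hc hd ?_)
    exact UnivDenom.clearsDenominators_of_mem_parameterProducts hact hc hp
  · rw [heq]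
    exact (hdvd C hC).trans hnμ
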